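/- Let $n\ge 3$, $M(n)=\{x\in[-1,1]^n:\sum_k x_k=0\}$, let $v_{n-1}$ be $(n-1)$-dimensional Lebesgue measure on the hyperplane $\{\sum_k x_k=0\}$, and $V_{n-1}=v_{n-1}(M(n))$. A random balanced sample (RBS) is a system of random variables $X_1,\dots,X_n$ with $\sum_k X_k=0$ almost surely, each uniformly distributed on $[-1,1]$. For a probability density $g_n:[0,1]\to[0,\infty)$, the corresponding Gerow–Robson density on $M(n)$, relative to $v_{n-1}$, is $$h(x)=\frac{g_n(\|x\|_\infty)}{(n-1)V_{n-1}\|x\|_\infty^{\,n-2}},\qquad \|x\|_\infty=\max_k|x_k| .$$ Let $P_n(r)=P\{|Z_2|\le r\}$ for $r\in[0,1]$, where $(Z_2,\dots,Z_n)$ is uniformly distributed, with respect to $(n-2)$-dimensional volume, on $\{z\in[-1,1]^{n-1}:\sum_k z_k=-1\}$. Let $H$ be the Heaviside function, $q_n(t)=H(t)\,g_n(e^{-t})$, $Q_n(t)=H(t)\,P_n'(e^{-t})$, and let $\mathcal L\psi(s)=\int_{-\infty}^{\infty}e^{-st}\psi(t)\,dt$ for $s>0$. Then $P_n$ is differentiable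 on $[0,1]$ (one-sidedly at the end points), $\mathcal LQ_n(s)$ converges for all $s>0$, and the Gerow–Robson density corresponding to $g_n$ defines an RBS distribution on $M(n)$ (that is, the coordinates of a random vector with this density form an RBS) if and only if, for every $s>0$, the integral $\mathcal Lq_n(s)$ converges and $$\mathcal L q_n(s)=\frac{n}{s\,\bigl(1+(n-1)\,\mathcal L Q_n(s)\bigr)} .$$ -/

import Mathlib

open MeasureTheory ProbabilityTheory Set

namespace GerowRobson

noncomputable section

/-- The vector `(1, 1, ..., 1)` of `ℝ^m`. -/
def ones (m : ℕ) : EuclideanSpace ℝ (Fin m) := WithLp.toLp 2 fun _ => 1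

/-- The `(m-1)`-dimensional Lebesgue measure on the affine hyperplane
`{x ∈ ℝ^m : ∑ k, x k = c}`, seen as a measure on `ℝ^m`: the image of the Lebesgue measure of the
Euclidean space `(1, ..., 1)^⊥` under the translation `w ↦ w + (c / m) • (1, ..., 1)`. -/
def hyperplaneVolume (m : ℕ) (c : ℝ) : Measure (EuclideanSpace ℝ (Fin m)) :=
  (volume : Measure (Submodule.span ℝ {ones m})ᗮ).map
    fun w : (Submodule.span ℝ {ones m})ᗮ =>
      (w : EuclideanSpace ℝ (Fin m)) + (c / (m : ℝ)) • ones m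

/-- The polytope `M(n)` of the balanced vectors in `[-1, 1]^n`. -/
def balancedPolytope (n : ℕ) : Set (EuclideanSpace ℝ (Fin n)) :=
  {x | (∀ k, x k ∈ Icc (-1 : ℝ) 1) ∧ ∑ k, x k = 0}

/-- `V_{n-1}`, the `(n-1)`-volume of `M(n)`. -/
def polytopeVolume (n : ℕ) : ℝ := (hyperplaneVolume n 0).real (balancedPolytope n)

/-- `‖x‖_∞ = max_k |x k|` (the norm of `Fin n → ℝ` is the sup norm). -/
def supNorm {n : ℕ} (x : EuclideanSpace ℝ (Fin n)) : ℝ := ‖(WithLp.ofLp x : Fin n → ℝ)‖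

/-- Random variables `X_1, ..., X_n` form a random balanced sample: their sum is `0` (almost
surely), and each of them is uniformly distributed over `[-1, 1]`. -/
structure IsRandomBalancedSample {Ω : Type*} [MeasurableSpace Ω] {n : ℕ}
    (X : Fin n → Ω → ℝ) (P : Measure Ω) : Prop where
  isProbabilityMeasure : IsProbabilityMeasure P
  measurable : ∀ k, Measurable (X k)
  balanced : ∀ᵐ ω ∂P, ∑ k, X k ω = 0
  uniform : ∀ k, pdf.IsUniform (X k) (Icc (-1 : ℝ) 1) P volume

/-- A probability measure on `ℝ^n` is a random balanced sample distribution if the coordinates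
form a random balanced sample under it. -/
def IsRBSDistribution {n : ℕ} (P : Measure (EuclideanSpace ℝ (Fin n))) : Prop :=
  IsRandomBalancedSample (fun (k : Fin n) (x : EuclideanSpace ℝ (Fin n)) => x k) P

/-- `g` is a probability density on `[0, 1]`; its values outside `[0, 1]` play no role. -/
structure IsUnitIntervalDensity (g : ℝ → ℝ) : Prop where
  nonneg : ∀ s ∈ Icc (0 : ℝ) 1, 0 ≤ g s
  integrableOn : IntegrableOn g (Icc 0 1)
  integral_eq_one : ∫ s in Icc (0 : ℝ) 1, g s = 1

/-- The Gerow–Robson density on `M(n)` corresponding to `g`: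
`h(x) = g(‖x‖_∞) / ((n - 1) V_{n-1} ‖x‖_∞^(n-2))`. -/
def density (n : ℕ) (g : ℝ → ℝ) (x : EuclideanSpace ℝ (Fin n)) : ℝ :=
  g (supNorm x) / (((n : ℝ) - 1) * polytopeVolume n * supNorm x ^ (n - 2))

/-- The measure on `M(n)` with that density relative to `(n-1)`-dimensional volume. -/
def law (n : ℕ) (g : ℝ → ℝ) : Measure (EuclideanSpace ℝ (Fin n)) :=
  ((hyperplaneVolume n 0).restrict (balancedPolytope n)).withDensity
    fun x => ENNReal.ofReal (density n g x)

/-- The uniform distribution, relative to `(n-2)`-dimensional volume, on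
`{(Z_2, ..., Z_n) ∈ [-1, 1]^(n-1) : ∑ k, Z_k = -1}`. -/
def sliceLaw (n : ℕ) : Measure (EuclideanSpace ℝ (Fin (n - 1))) :=
  cond (hyperplaneVolume (n - 1) (-1)) {z | ∀ k, z k ∈ Icc (-1 : ℝ) 1}

/-- `P_n(r)`, the probability of `|Z_2| ≤ r` when `(Z_2, ..., Z_n)` has the law `sliceLaw n`. -/
def sliceCDF (n : ℕ) (hn : 3 ≤ n) (r : ℝ) : ℝ :=
  (sliceLaw n).real {z | |z ⟨0, by omega⟩| ≤ r}

/-- The Heaviside function. -/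
def heaviside (t : ℝ) : ℝ := if 0 ≤ t then 1 else 0

/-- `q_n(t) = H(t) g(e^{-t})`. -/
def smallQ (g : ℝ → ℝ) (t : ℝ) : ℝ := heaviside t * g (Real.exp (-t))

/-- `Q_n(t) = H(t) P_n'(e^{-t})`; the derivative is that of `P_n` as a function on `[0, 1]`
(one-sided at the end points). -/
def bigQ (n : ℕ) (hn : 3 ≤ n) (t : ℝ) : ℝ :=
  heaviside t * derivWithin (sliceCDF n hn) (Icc 0 1) (Real.exp (-t))

/-- The Laplace integral of `ψ` at `s` converges (absolutely). -/
def LaplaceConverges (ψ : ℝ → ℝ) (s : ℝ) : Prop :=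
  Integrable fun t : ℝ => Real.exp (-s * t) * ψ t

/-- The Laplace transform `∫ e^{-st} ψ(t) dt` over the real line. -/
def laplace (ψ : ℝ → ℝ) (s : ℝ) : ℝ := ∫ t : ℝ, Real.exp (-s * t) * ψ t

end

end GerowRobson

namespace GerowRobson

open scoped ENNReal NNReal

noncomputable section

/-! Polar coordinates for the sup norm turn the statement into an identity of moments. Let `X` have
the Gerow–Robson density. The factor `‖x‖_∞^(n-2)` in the denominator cancels the polar Jacobian, so
`R = ‖X‖_∞` has density `g`. Up to sign, the face of the sphere `‖x‖_∞ = 1` on which a given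
coordinate is `1` is a slice of the cube with coordinate sum `-1`. By symmetry, `|X_j|` is therefore
`R` with probability `1/n` and `R |Z_2|` with probability `(n-1)/n`, where `Z_2` is independent of
`R` (`lintegral_supNorm_abs_apply`, `lintegral_law_abs_apply`).

Write `m_f(s) = ∫_0^1 r^(s-1) f(r) dr`. Then `E|X_j|^(s-1) = m_g(s) (1 + (n-1) m_p(s)) / n` with `p
= P_n'` (`lintegral_rpow_abs_apply_law`), and the substitution `r = e^(-t)` makes `m_g` and `m_p`
the Laplace transforms of `q_n` and `Q_n`. The law is invariant under `x ↦ -x`, so `X_j` is uniform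
on `[-1, 1]` iff `|X_j|` is uniform on `[0, 1]`, that is, iff these moments equal `1/s`; integer
moments already determine a measure on `[0, 1]` (`map_apply_law_eq_cond_iff`). Solving for `m_g(s)`
in `[0, ∞]` yields the formula together with convergence (`moment_identity_iff`). -/

/-! ### The hyperplane measure in coordinates -/

/-- The chart `u ↦ (c - ∑ u, u)` of the hyperplane `{x ∈ ℝ^(m+1) : ∑ x = c}`. -/
def hyperplaneChart (m : ℕ) (c : ℝ) (u : Fin m → ℝ) : EuclideanSpace ℝ (Fin (m + 1)) :=
  WithLp.toLp 2 (Fin.cons (c - ∑ i, u i) u : Fin (m + 1) → ℝ)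

@[simp] lemma hyperplaneChart_zero (m : ℕ) (c : ℝ) (u : Fin m → ℝ) :
    hyperplaneChart m c u 0 = c - ∑ i, u i := rfl

@[simp] lemma hyperplaneChart_succ (m : ℕ) (c : ℝ) (u : Fin m → ℝ) (i : Fin m) :
    hyperplaneChart m c u i.succ = u i := rfl

lemma sum_hyperplaneChart (m : ℕ) (c : ℝ) (u : Fin m → ℝ) :
    ∑ i, hyperplaneChart m c u i = c := by
  simp [Fin.sum_univ_succ]

lemma measurable_hyperplaneChart (m : ℕ) (c : ℝ) : Measurable (hyperplaneChart m c) := by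
  refine (PiLp.volume_preserving_toLp (Fin (m + 1))).measurable.comp ?_
  refine measurable_pi_lambda _ fun i => ?_
  refine Fin.cases ?_ (fun j => ?_) i
  · simp only [Fin.cons_zero]; fun_prop
  · simp only [Fin.cons_succ]; fun_prop

/-- The image of Lebesgue measure under the chart `hyperplaneChart m c`. -/
def chartMeasure (m : ℕ) (c : ℝ) : Measure (EuclideanSpace ℝ (Fin (m + 1))) :=
  volume.map (hyperplaneChart m c)

lemma mem_orthogonal_span_ones {m : ℕ} {x : EuclideanSpace ℝ (Fin m)} :
    x ∈ (Submodule.span ℝ {ones m})ᗮ ↔ ∑ i, x i = 0 := by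
  rw [Submodule.mem_orthogonal_singleton_iff_inner_right]
  simp [ones, PiLp.inner_apply]

lemma hyperplaneChart_add (m : ℕ) (u v : Fin m → ℝ) :
    hyperplaneChart m 0 (u + v) = hyperplaneChart m 0 u + hyperplaneChart m 0 v := by
  ext i
  refine Fin.cases ?_ (fun j => ?_) i
  · simp [Finset.sum_add_distrib]; ring
  · simp

lemma hyperplaneChart_smul (m : ℕ) (a : ℝ) (u : Fin m → ℝ) :
    hyperplaneChart m 0 (a • u) = a • hyperplaneChart m 0 u := by
  ext i
  refine Fin.cases ?_ (fun j => ?_) i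
  · simp [Finset.mul_sum]
  · simp

/-- The chart of the hyperplane through the origin as a linear equivalence. -/
def linearChart (m : ℕ) : (Fin m → ℝ) ≃ₗ[ℝ] (Submodule.span ℝ {ones (m + 1)})ᗮ where
  toFun u := ⟨hyperplaneChart m 0 u, mem_orthogonal_span_ones.2 (sum_hyperplaneChart m 0 u)⟩
  invFun w i := (w : EuclideanSpace ℝ (Fin (m + 1))) i.succ
  map_add' u v := Subtype.ext (hyperplaneChart_add m u v)
  map_smul' a u := Subtype.ext (hyperplaneChart_smul m a u)
  left_inv u := by simp
  right_inv w := by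
    have h := mem_orthogonal_span_ones.1 w.2
    rw [Fin.sum_univ_succ] at h
    ext i
    refine Fin.cases ?_ (fun j => ?_) i
    · simp; linarith
    · simp

/-- Uniqueness of Haar measure on `(1, ..., 1)^⊥`. The value of `κ` is never needed, because it
cancels in both normalised laws. -/
lemma exists_hyperplaneVolume_eq_smul_chartMeasure (m : ℕ) :
    ∃ κ : ℝ≥0, κ ≠ 0 ∧ ∀ c, hyperplaneVolume (m + 1) c = κ • chartMeasure m c := by
  set μ : Measure (Submodule.span ℝ {ones (m + 1)})ᗮ :=
    (volume : Measure (Fin m → ℝ)).map (linearChart m)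
    with hμ
  have hH : μ.IsAddHaarMeasure := inferInstance
  refine ⟨Measure.addHaarScalarFactor volume μ,
    (Measure.addHaarScalarFactor_pos_of_isAddHaarMeasure _ _).ne', fun c => ?_⟩
  rw [hyperplaneVolume]
  conv_lhs => rw [Measure.isAddLeftInvariant_eq_smul (volume : Measure _) μ]
  rw [Measure.map_smul]
  congr 1
  have hL : Measurable (linearChart m) :=
    (linearChart m).toContinuousLinearEquiv.continuous.measurable
  rw [hμ, Measure.map_map (by fun_prop) hL, chartMeasure]
  have hm : (m + 1 : ℝ) ≠ 0 := by positivity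
  -- Moving the hyperplane along `ones` is a translation of the chart parameter, which preserves
  -- Lebesgue measure; hence one `κ` serves every `c`.
  have : (fun w : (Submodule.span ℝ {ones (m + 1)})ᗮ =>
      (w : EuclideanSpace ℝ (Fin (m + 1))) + (c / ((m + 1 : ℕ) : ℝ)) • ones (m + 1)) ∘ linearChart m
      = hyperplaneChart m c ∘ fun u => u + fun _ => c / (m + 1 : ℝ) := by
    funext u
    change hyperplaneChart m 0 u + (c / ((m + 1 : ℕ) : ℝ)) • ones (m + 1)
      = hyperplaneChart m c (u + fun _ => c / (m + 1 : ℝ))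
    ext i
    refine Fin.cases ?_ (fun j => ?_) i
    · simp [ones, Finset.sum_add_distrib]
      field_simp
      ring
    · simp [ones]
  rw [this, ← Measure.map_map (measurable_hyperplaneChart m c) (by fun_prop),
    map_add_right_eq_self]

/-- The coordinate permutation `x ↦ x ∘ e`. -/
def permuteCoords {m : ℕ} (e : Equiv.Perm (Fin m)) (x : EuclideanSpace ℝ (Fin m)) :
    EuclideanSpace ℝ (Fin m) := WithLp.toLp 2 fun i => x (e i)

@[simp] lemma permuteCoords_apply {m : ℕ} (e : Equiv.Perm (Fin m)) (x : EuclideanSpace ℝ (Fin m))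
    (i : Fin m) : permuteCoords e x i = x (e i) := rfl

lemma measurable_permuteCoords {m : ℕ} (e : Equiv.Perm (Fin m)) :
    Measurable (permuteCoords e) := by
  refine (PiLp.volume_preserving_toLp (Fin m)).measurable.comp ?_
  fun_prop

/-- Permutations fix `ones` and act isometrically on its orthogonal complement. The chart singles
out coordinate `0`, so the symmetry is proved here and then transported to `chartMeasure`. -/
lemma map_permuteCoords_hyperplaneVolume (m : ℕ) (c : ℝ) (e : Equiv.Perm (Fin m)) :
    (hyperplaneVolume m c).map (permuteCoords e) = hyperplaneVolume m c := by
  let f : (Submodule.span ℝ {ones m})ᗮ →ₗᵢ[ℝ] (Submodule.span ℝ {ones m})ᗮ :=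
    { toFun := fun w => ⟨permuteCoords e w, by
        have h := mem_orthogonal_span_ones.1 w.2
        rw [mem_orthogonal_span_ones]
        simpa [Equiv.sum_comp e fun i => (w : EuclideanSpace ℝ (Fin m)) i] using h⟩
      map_add' := fun u v => by ext i; simp
      map_smul' := fun a u => by ext i; simp
      norm_map' := fun w => by
        simp only [LinearMap.coe_mk, AddHom.coe_mk, Submodule.coe_norm]
        rw [EuclideanSpace.norm_eq, EuclideanSpace.norm_eq]
        simp only [permuteCoords_apply]
        rw [Equiv.sum_comp e fun i => ‖(w : EuclideanSpace ℝ (Fin m)) i‖ ^ 2] }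
  have hf := (f.toLinearIsometryEquiv rfl).measurePreserving
  rw [hyperplaneVolume, Measure.map_map (measurable_permuteCoords e) (by fun_prop)]
  conv_rhs => rw [← hf.map_eq, Measure.map_map (by fun_prop) hf.measurable]
  congr 1

lemma map_permuteCoords_chartMeasure (m : ℕ) (c : ℝ) (e : Equiv.Perm (Fin (m + 1))) :
    (chartMeasure m c).map (permuteCoords e) = chartMeasure m c := by
  obtain ⟨κ, hκ, h⟩ := exists_hyperplaneVolume_eq_smul_chartMeasure m
  have := map_permuteCoords_hyperplaneVolume (m + 1) c e
  rw [h c, Measure.map_smul] at this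
  have h2 := congrArg (fun μ => κ⁻¹ • μ) this
  simpa [smul_smul, hκ] using h2

lemma lintegral_permuteCoords_chartMeasure {m : ℕ} (c : ℝ) (e : Equiv.Perm (Fin (m + 1)))
    {F : EuclideanSpace ℝ (Fin (m + 1)) → ℝ≥0∞} (hF : Measurable F) :
    ∫⁻ x, F (permuteCoords e x) ∂(chartMeasure m c) = ∫⁻ x, F x ∂(chartMeasure m c) := by
  conv_rhs => rw [← map_permuteCoords_chartMeasure m c e]
  rw [lintegral_map hF (measurable_permuteCoords e)]

lemma lintegral_neg_chartMeasure {m : ℕ} {F : EuclideanSpace ℝ (Fin (m + 1)) → ℝ≥0∞}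
    (hF : Measurable F) :
    ∫⁻ x, F (-x) ∂(chartMeasure m 0) = ∫⁻ x, F x ∂(chartMeasure m 0) := by
  have hneg : ∀ u : Fin m → ℝ, -hyperplaneChart m 0 u = hyperplaneChart m 0 (-u) := by
    intro u
    ext i
    refine Fin.cases ?_ (fun j => ?_) i <;> simp
  rw [chartMeasure, lintegral_map (by fun_prop) (measurable_hyperplaneChart m 0),
    lintegral_map hF (measurable_hyperplaneChart m 0)]
  simp_rw [hneg]
  exact (Measure.measurePreserving_neg (volume : Measure (Fin m → ℝ))).lintegral_comp
    (hF.comp (measurable_hyperplaneChart m 0))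

/-- Integration against `chartMeasure`, with the coordinate of index `1` integrated last. -/
lemma lintegral_chartMeasure_succ {m : ℕ} (c : ℝ) {F : EuclideanSpace ℝ (Fin (m + 2)) → ℝ≥0∞}
    (hF : Measurable F) :
    ∫⁻ x, F x ∂(chartMeasure (m + 1) c) =
      ∫⁻ t : ℝ, ∫⁻ w : Fin m → ℝ,
        F (hyperplaneChart (m + 1) c (Fin.cons t w : Fin (m + 1) → ℝ)) := by
  have hG : Measurable fun u => F (hyperplaneChart (m + 1) c u) :=
    hF.comp (measurable_hyperplaneChart _ _)
  rw [chartMeasure, lintegral_map hF (measurable_hyperplaneChart _ _)]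
  have hp := (volume_preserving_piFinSuccAbove (fun _ : Fin (m + 1) => ℝ) 0).symm
  have hGp := (hG.comp hp.measurable).aemeasurable (μ := volume)
  rw [Function.comp_def] at hGp
  rw [← hp.lintegral_comp hG, Measure.volume_eq_prod, lintegral_prod _ hGp]
  simp [MeasurableEquiv.piFinSuccAbove, Fin.consEquiv]

/-! ### The slice of the cube -/

lemma lintegral_eq_lintegral_Ioi_add_neg {G : ℝ → ℝ≥0∞} (hG : Measurable G) :
    ∫⁻ t, G t = ∫⁻ t in Ioi 0, (G t + G (-t)) := by
  have hGn : Measurable fun t => G (-t) := by fun_prop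
  rw [lintegral_add_left hG, ← lintegral_add_compl G (measurableSet_Ioi (a := (0 : ℝ))), compl_Ioi]
  congr 1
  have h := (Measure.measurePreserving_neg (volume : Measure ℝ)).setLIntegral_comp_preimage
    (measurableSet_Iic (a := (0 : ℝ))) hG
  rw [← h]
  have : (Neg.neg ⁻¹' Iic (0 : ℝ)) = Ici 0 := by ext; simp
  rw [this]
  exact setLIntegral_congr Ioi_ae_eq_Ici.symm

lemma lintegral_comp_abs {G : ℝ → ℝ≥0∞} (hG : Measurable G) :
    ∫⁻ t, G |t| = 2 * ∫⁻ t in Ioi 0, G t := by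
  rw [lintegral_eq_lintegral_Ioi_add_neg (G := fun t => G |t|) (by fun_prop),
    ← lintegral_const_mul 2 hG]
  refine setLIntegral_congr_fun measurableSet_Ioi fun t ht => ?_
  simp [abs_of_pos (mem_Ioi.1 ht), two_mul]

lemma lintegral_eq_mul_lintegral_comp_smul {m : ℕ} {F : (Fin m → ℝ) → ℝ≥0∞} (hF : Measurable F)
    {t : ℝ} (ht : t ≠ 0) :
    ∫⁻ w, F w = ENNReal.ofReal (|t| ^ m) * ∫⁻ w, F (t • w) := by
  have h := congrArg (fun μ => ∫⁻ w, F w ∂μ)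
    (Measure.map_addHaar_smul (volume : Measure (Fin m → ℝ)) ht)
  simp only [lintegral_smul_measure, Module.finrank_fin_fun] at h
  rw [lintegral_map hF (by fun_prop)] at h
  have hpos : 0 < |t| ^ m := by positivity
  rw [h, smul_eq_mul, ← mul_assoc, ← ENNReal.ofReal_mul hpos.le, abs_inv, abs_pow,
    mul_inv_cancel₀ hpos.ne', ENNReal.ofReal_one, one_mul]

/-- As `c ≠ 0`, the origin is excluded and the affine subspace is proper. This covers `k = 0` too,
where the set is empty. -/
lemma volume_setOf_sum_eq {k : ℕ} {c : ℝ} (hc : c ≠ 0) :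
    volume {w : Fin k → ℝ | ∑ i, w i = c} = 0 := by
  let s : AffineSubspace ℝ (Fin k → ℝ) :=
    { carrier := {w | ∑ i, w i = c}
      smul_vsub_vadd_mem' := fun a p q r hp hq hr => by
        simp only [mem_ofPred_eq] at *
        simp [Finset.sum_add_distrib, ← Finset.mul_sum, hp, hq, hr] }
  refine Measure.addHaar_affineSubspace volume s fun h => hc ?_
  have h0 : (0 : Fin k → ℝ) ∈ s := h ▸ AffineSubspace.mem_top ℝ _ _
  have h1 : ∑ i, (0 : Fin k → ℝ) i = c := h0
  simpa using h1.symm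

/-- The cube `[-1, 1]^m`. -/
def cube (m : ℕ) : Set (EuclideanSpace ℝ (Fin m)) := {z | ∀ k, z k ∈ Icc (-1 : ℝ) 1}

lemma measurableSet_cube (m : ℕ) : MeasurableSet (cube m) := by
  have : cube m = ⋂ k, (fun z : EuclideanSpace ℝ (Fin m) => z k) ⁻¹' Icc (-1 : ℝ) 1 := by
    ext; simp [cube]
  rw [this]
  exact MeasurableSet.iInter fun k => measurableSet_Icc.preimage (by fun_prop)

/-- The unnormalised density of `|z 0|` on the slice `{z ∈ [-1, 1]^(k+2) : ∑ z = -1}`. -/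
def sliceWeight (k : ℕ) (r : ℝ) : ℝ≥0∞ :=
  volume {w : Fin k → ℝ | (∀ i, w i ∈ Icc (-1 : ℝ) 1) ∧ |r - ∑ i, w i| ≤ 2}

/-- The unnormalised density of `z 0` on the slice `{z ∈ [-1, 1]^(k+2) : ∑ z = -1}`. -/
def signedSliceWeight (k : ℕ) (y : ℝ) : ℝ≥0∞ :=
  volume {w : Fin k → ℝ | (∀ i, w i ∈ Icc (-1 : ℝ) 1) ∧ |1 + y + ∑ i, w i| ≤ 1}

lemma measurableSet_setOf_forall_mem_Icc (k : ℕ) :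
    MeasurableSet {w : Fin k → ℝ | ∀ i, w i ∈ Icc (-1 : ℝ) 1} := by
  rw [ofPred_forall]
  exact MeasurableSet.iInter fun i => measurableSet_Icc.preimage (measurable_pi_apply i)

lemma measurableSet_setOf_and {α : Type*} [MeasurableSpace α] {p q : α → Prop}
    (hp : MeasurableSet {a | p a}) (hq : MeasurableSet {a | q a}) :
    MeasurableSet {a | p a ∧ q a} := hp.inter hq

lemma measurable_signedSliceWeight (k : ℕ) : Measurable (signedSliceWeight k) := by
  have h : MeasurableSet {p : ℝ × (Fin k → ℝ) |
      (∀ i, p.2 i ∈ Icc (-1 : ℝ) 1) ∧ |1 + p.1 + ∑ i, p.2 i| ≤ 1} :=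
    measurableSet_setOf_and ((measurableSet_setOf_forall_mem_Icc k).preimage measurable_snd)
      (measurableSet_le (by fun_prop) measurable_const)
  exact measurable_measure_prodMk_left h

lemma measurable_sliceWeight (k : ℕ) : Measurable (sliceWeight k) := by
  have h : MeasurableSet {p : ℝ × (Fin k → ℝ) |
      (∀ i, p.2 i ∈ Icc (-1 : ℝ) 1) ∧ |p.1 - ∑ i, p.2 i| ≤ 2} :=
    measurableSet_setOf_and ((measurableSet_setOf_forall_mem_Icc k).preimage measurable_snd)
      (measurableSet_le (by fun_prop) measurable_const)
  exact measurable_measure_prodMk_left h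

/-- With `σ = ∑ w`, and after `w ↦ -w` in the first term, the two conditions read `σ ∈ [r, r + 2]`
and `σ ∈ [r - 2, r]`. They overlap only in the null set `σ = r` and together give `|r - σ| ≤ 2`. -/
lemma signedSliceWeight_add_neg (k : ℕ) {r : ℝ} (hr : 0 < r) :
    signedSliceWeight k r + signedSliceWeight k (-r) = sliceWeight k r := by
  have h1 : signedSliceWeight k r = volume {w : Fin k → ℝ | (∀ i, w i ∈ Icc (-1 : ℝ) 1) ∧
      |1 + r - ∑ i, w i| ≤ 1} := by
    rw [signedSliceWeight, ← Measure.measure_neg]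
    congr 1
    ext w
    simp only [Set.mem_neg, mem_ofPred_eq, Pi.neg_apply, mem_Icc, Finset.sum_neg_distrib,
      ← sub_eq_add_neg]
    refine and_congr_left fun _ => forall_congr' fun i => ?_
    constructor <;> rintro ⟨_, _⟩ <;> constructor <;> linarith
  have hm := measurableSet_setOf_forall_mem_Icc k
  rw [h1, signedSliceWeight, sliceWeight, ← measure_union₀]
  · congr 1
    ext w
    simp only [mem_union, mem_ofPred_eq, ← and_or_left, abs_le]
    refine and_congr_right fun _ => ?_
    constructor
    · rintro (⟨_, _⟩ | ⟨_, _⟩) <;> constructor <;> linarith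
    · rintro ⟨_, _⟩
      rcases le_total r (∑ i, w i) with h | h
      · left; constructor <;> linarith
      · right; constructor <;> linarith
  · exact (measurableSet_setOf_and hm
      (measurableSet_le (by fun_prop) measurable_const)).nullMeasurableSet
  · refine measure_mono_null ?_ (volume_setOf_sum_eq (k := k) hr.ne')
    rintro w ⟨⟨_, hw1⟩, ⟨_, hw2⟩⟩
    rw [abs_le] at hw1 hw2
    simp only [mem_ofPred_eq]
    linarith [hw1.2, hw2.1, hw1.1, hw2.2]

/-- Up to normalisation this is the law of `|Z_2|`, by Fubini in the chart. -/
lemma lintegral_cube_chartMeasure (k : ℕ) {ψ : ℝ → ℝ≥0∞} (hψ : Measurable ψ) :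
    ∫⁻ z in cube (k + 2), ψ |z 0| ∂(chartMeasure (k + 1) (-1)) =
      ∫⁻ y in Icc 0 1, ψ y * sliceWeight k y := by
  have hF : ∀ i : Fin (k + 2), Measurable ((cube (k + 2)).indicator fun z => ψ |z i|) := fun i =>
    Measurable.indicator (by fun_prop) (measurableSet_cube _)
  rw [← lintegral_indicator (measurableSet_cube _)]
  -- Coordinate `0` is the dependent one in the chart, so the observed coordinate is moved to the
  -- free index `1`.
  have hswap : ∀ z : EuclideanSpace ℝ (Fin (k + 2)),
      (cube (k + 2)).indicator (fun z => ψ |z 0|) (permuteCoords (Equiv.swap 0 1) z)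
        = (cube (k + 2)).indicator (fun z => ψ |z 1|) z := by
    intro z
    have : permuteCoords (Equiv.swap 0 1) z ∈ cube (k + 2) ↔ z ∈ cube (k + 2) := by
      simp only [cube, mem_ofPred_eq, permuteCoords_apply]
      exact (Equiv.swap (0 : Fin (k + 2)) 1).forall_congr_left.trans (by simp)
    by_cases h : z ∈ cube (k + 2)
    · rw [indicator_of_mem (this.2 h), indicator_of_mem h]; simp
    · rw [indicator_of_notMem (mt this.1 h), indicator_of_notMem h]
  rw [← lintegral_permuteCoords_chartMeasure _ (Equiv.swap 0 1) (hF 0)]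
  simp_rw [hswap]
  rw [lintegral_chartMeasure_succ _ (hF 1)]
  have hinner : ∀ y : ℝ, ∫⁻ w : Fin k → ℝ, (cube (k + 2)).indicator (fun z => ψ |z 1|)
      (hyperplaneChart (k + 1) (-1) (Fin.cons y w : Fin (k + 1) → ℝ)) =
      (Icc (-1 : ℝ) 1).indicator (fun y => ψ |y| * signedSliceWeight k y) y := by
    intro y
    have hmem : ∀ w : Fin k → ℝ,
        hyperplaneChart (k + 1) (-1) (Fin.cons y w : Fin (k + 1) → ℝ) ∈ cube (k + 2) ↔
        y ∈ Icc (-1 : ℝ) 1 ∧ (∀ i, w i ∈ Icc (-1 : ℝ) 1) ∧ |1 + y + ∑ i, w i| ≤ 1 := by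
      intro w
      simp only [cube, mem_ofPred_eq, Fin.forall_fin_succ, hyperplaneChart_zero,
        hyperplaneChart_succ, Fin.sum_univ_succ, Fin.cons_zero, Fin.cons_succ, mem_Icc, abs_le]
      constructor
      · rintro ⟨⟨_, _⟩, h, h'⟩
        exact ⟨h, h', by linarith, by linarith⟩
      · rintro ⟨h, h', _, _⟩
        exact ⟨⟨by linarith, by linarith⟩, h, h'⟩
    by_cases hy : y ∈ Icc (-1 : ℝ) 1
    · rw [indicator_of_mem hy, signedSliceWeight, ← setLIntegral_const, ← lintegral_indicator]
      · refine lintegral_congr fun w => ?_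
        simp only [indicator, hmem, hy, true_and, mem_ofPred_eq]
        rfl
      · exact measurableSet_setOf_and (measurableSet_setOf_forall_mem_Icc k)
          (measurableSet_le (by fun_prop) measurable_const)
    · rw [indicator_of_notMem hy]
      simp [indicator, hmem, hy]
  simp_rw [hinner]
  have hsw := measurable_signedSliceWeight k
  rw [lintegral_eq_lintegral_Ioi_add_neg
    (Measurable.indicator (by fun_prop) measurableSet_Icc), ← lintegral_indicator measurableSet_Ioi,
    setLIntegral_congr Ioc_ae_eq_Icc.symm, ← lintegral_indicator measurableSet_Ioc]
  refine lintegral_congr fun y => ?_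
  by_cases hy0 : 0 < y
  · by_cases hy1 : y ≤ 1
    · rw [indicator_of_mem (mem_Ioi.2 hy0), indicator_of_mem (mem_Ioc.2 ⟨hy0, hy1⟩),
        indicator_of_mem (mem_Icc.2 ⟨by linarith, hy1⟩),
        indicator_of_mem (mem_Icc.2 ⟨by linarith, by linarith⟩), abs_neg,
        abs_of_pos hy0, ← mul_add, signedSliceWeight_add_neg k hy0]
    · rw [indicator_of_mem (mem_Ioi.2 hy0), indicator_of_notMem fun h => hy1 (mem_Icc.1 h).2,
        indicator_of_notMem fun h => hy1 (by linarith [(mem_Icc.1 h).1]),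
        indicator_of_notMem fun h => hy1 (mem_Ioc.1 h).2, add_zero]
  · rw [indicator_of_notMem fun h => hy0 (mem_Ioi.1 h),
      indicator_of_notMem fun h => hy0 (mem_Ioc.1 h).1]

/-! ### The joint law of the sup norm and of a coordinate -/

/-- The cone of the vectors whose `i`-th coordinate has the largest absolute value. -/
def dominantCone {m : ℕ} (i : Fin m) : Set (EuclideanSpace ℝ (Fin m)) :=
  {x | ∀ l, |x l| ≤ |x i|}

lemma measurableSet_dominantCone {m : ℕ} (i : Fin m) : MeasurableSet (dominantCone i) := by
  rw [dominantCone, ofPred_forall]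
  exact MeasurableSet.iInter fun l => measurableSet_le (by fun_prop) (by fun_prop)

lemma supNorm_eq_of_mem_dominantCone {m : ℕ} {i : Fin m} {x : EuclideanSpace ℝ (Fin m)}
    (hx : x ∈ dominantCone i) : supNorm x = |x i| :=
  le_antisymm ((pi_norm_le_iff_of_nonneg (abs_nonneg _)).2 hx)
    (norm_le_pi_norm (WithLp.ofLp x : Fin m → ℝ) i)

lemma measurable_supNorm {m : ℕ} : Measurable (supNorm (n := m)) :=
  measurable_norm.comp (PiLp.volume_preserving_ofLp (Fin m)).measurable

/-- Reduces any pair (dominant index, observed index) to `(0, 0)` or `(0, 1)`. -/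
lemma lintegral_dominantCone_perm {m : ℕ} (c : ℝ) (e : Equiv.Perm (Fin (m + 1)))
    {φ : ℝ → ℝ → ℝ≥0∞} (hφ : Measurable (Function.uncurry φ)) (a b : Fin (m + 1)) :
    ∫⁻ x in dominantCone (e a), φ |x (e a)| |x (e b)| ∂(chartMeasure m c) =
      ∫⁻ x in dominantCone a, φ |x a| |x b| ∂(chartMeasure m c) := by
  have hm : Measurable fun x : EuclideanSpace ℝ (Fin (m + 1)) => φ |x a| |x b| :=
    hφ.comp (Measurable.prodMk (by fun_prop) (by fun_prop))
  rw [← lintegral_indicator (measurableSet_dominantCone _),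
    ← lintegral_indicator (measurableSet_dominantCone _),
    ← lintegral_permuteCoords_chartMeasure c e (hm.indicator (measurableSet_dominantCone a))]
  refine lintegral_congr fun x => ?_
  have : permuteCoords e x ∈ dominantCone a ↔ x ∈ dominantCone (e a) := by
    simp only [dominantCone, mem_ofPred_eq, permuteCoords_apply]
    exact e.forall_congr_left.trans (by simp)
  by_cases h : x ∈ dominantCone (e a)
  · rw [indicator_of_mem (this.2 h), indicator_of_mem h]; simp
  · rw [indicator_of_notMem (mt this.1 h), indicator_of_notMem h]

lemma measurable_lintegral_mul_sliceWeight (k : ℕ) {φ : ℝ → ℝ → ℝ≥0∞}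
    (hφ : Measurable (Function.uncurry φ)) :
    Measurable fun t : ℝ => ∫⁻ y in Icc 0 1, φ t (t * y) * sliceWeight k y := by
  have h : Measurable fun p : ℝ × ℝ => φ p.1 (p.1 * p.2) * sliceWeight k p.2 :=
    (hφ.comp (measurable_fst.prodMk (measurable_fst.mul measurable_snd))).mul
      ((measurable_sliceWeight k).comp measurable_snd)
  exact h.lintegral_prod_right'

/-- Dividing by the dominant coordinate `t` sends the other coordinates to the slice of the cube
with sum `-1`. The `k + 1` free ones among them give the Jacobian `|t|^(k+1)`, and the two signs of
`t` give the factor `2`. -/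
lemma lintegral_dominantCone (k : ℕ) {φ : ℝ → ℝ → ℝ≥0∞} (hφ : Measurable (Function.uncurry φ)) :
    ∫⁻ x in dominantCone 0, φ |x 0| |x 1| ∂(chartMeasure (k + 2) 0) =
      2 * ∫⁻ t in Ioi 0, ENNReal.ofReal (t ^ (k + 1)) *
        ∫⁻ y in Icc 0 1, φ t (t * y) * sliceWeight k y := by
  have hm : Measurable fun x : EuclideanSpace ℝ (Fin (k + 3)) => φ |x 1| |x 0| :=
    hφ.comp (Measurable.prodMk (by fun_prop) (by fun_prop))
  -- The dominant coordinate is placed at index `1`, the outer variable in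
  -- `lintegral_chartMeasure_succ`.
  have hm' := hm.indicator (measurableSet_dominantCone 1)
  have hperm := lintegral_dominantCone_perm 0 (Equiv.swap (0 : Fin (k + 3)) 1) hφ 0 1
  simp only [Equiv.swap_apply_left, Equiv.swap_apply_right] at hperm
  rw [← hperm, ← lintegral_indicator (measurableSet_dominantCone _),
    lintegral_chartMeasure_succ _ hm']
  have hH := measurable_lintegral_mul_sliceWeight k hφ
  rw [← lintegral_comp_abs (G := fun t => ENNReal.ofReal (t ^ (k + 1)) *
        ∫⁻ y in Icc 0 1, φ t (t * y) * sliceWeight k y) (by fun_prop)]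
  refine lintegral_congr_ae ?_
  filter_upwards [Measure.ae_ne volume (0 : ℝ)] with t ht
  have hpos : 0 < |t| := abs_pos.2 ht
  have hmw : Measurable fun w : Fin (k + 1) → ℝ =>
      (hyperplaneChart (k + 2) 0 (Fin.cons t w : Fin (k + 2) → ℝ)) := by
    refine (measurable_hyperplaneChart _ _).comp (measurable_pi_lambda _ fun i => ?_)
    refine Fin.cases ?_ (fun j => ?_) i
    · simp only [Fin.cons_zero]; fun_prop
    · simp only [Fin.cons_succ]; fun_prop
  have hψ : Measurable fun y : ℝ => φ |t| (|t| * y) :=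
    hφ.comp (Measurable.prodMk (by fun_prop) (by fun_prop))
  refine (lintegral_eq_mul_lintegral_comp_smul (F := fun w => (dominantCone 1).indicator
    (fun x => φ |x 1| |x 0|) (hyperplaneChart (k + 2) 0 (Fin.cons t w : Fin (k + 2) → ℝ)))
    (hm'.comp hmw) ht).trans ?_
  rw [← lintegral_cube_chartMeasure k hψ, ← lintegral_indicator (measurableSet_cube _),
    chartMeasure, lintegral_map (Measurable.indicator (by fun_prop) (measurableSet_cube _))
      (measurable_hyperplaneChart _ _)]
  congr 1
  refine lintegral_congr fun w => ?_
  have h0 : hyperplaneChart (k + 2) 0 (Fin.cons t (t • w) : Fin (k + 2) → ℝ) 0 =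
      t * hyperplaneChart (k + 1) (-1) w 0 := by
    simp [Fin.sum_univ_succ, ← Finset.mul_sum]
    ring
  have h1 : hyperplaneChart (k + 2) 0 (Fin.cons t (t • w) : Fin (k + 2) → ℝ) 1 = t := rfl
  have h2 : ∀ l : Fin (k + 1), hyperplaneChart (k + 2) 0 (Fin.cons t (t • w) : Fin (k + 2) → ℝ)
      l.succ.succ = t * hyperplaneChart (k + 1) (-1) w l.succ := fun l => rfl
  have hmem : hyperplaneChart (k + 2) 0 (Fin.cons t (t • w) : Fin (k + 2) → ℝ) ∈ dominantCone 1 ↔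
      hyperplaneChart (k + 1) (-1) w ∈ cube (k + 2) := by
    have key : ∀ z : ℝ, |t * z| ≤ |t| ↔ z ∈ Icc (-1 : ℝ) 1 := fun z => by
      rw [abs_mul, mul_le_iff_le_one_right hpos, abs_le, mem_Icc]
    simp only [dominantCone, cube, mem_ofPred_eq]
    rw [Fin.forall_fin_succ, Fin.forall_fin_succ,
      Fin.forall_fin_succ (P := fun i => hyperplaneChart (k + 1) (-1) w i ∈ Icc (-1 : ℝ) 1)]
    simp only [h0, h2, h1, key, Fin.succ_zero_eq_one, le_refl, true_and]
  by_cases h : hyperplaneChart (k + 1) (-1) w ∈ cube (k + 2)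
  · rw [indicator_of_mem (hmem.2 h), indicator_of_mem h, h0, h1, abs_mul]
  · rw [indicator_of_notMem (mt hmem.1 h), indicator_of_notMem h]

/-- The set is the union of two subspaces `x i = ± x l`, which are proper because `e_i - e_m`, with
a third index `m`, has sum zero and lies in neither. With only two coordinates the claim would fail.
-/
lemma chartMeasure_setOf_abs_eq (k : ℕ) {i l : Fin (k + 3)} (hil : i ≠ l) :
    chartMeasure (k + 2) 0 {x | |x i| = |x l|} = 0 := by
  have key : ∀ ε : ℝ, chartMeasure (k + 2) 0 {x | x i = ε * x l} = 0 := by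
    intro ε
    have hms : MeasurableSet {x : EuclideanSpace ℝ (Fin (k + 3)) | x i = ε * x l} :=
      measurableSet_eq_fun (by fun_prop) (by fun_prop)
    rw [chartMeasure, Measure.map_apply (measurable_hyperplaneChart _ _) hms]
    let f : (Fin (k + 2) → ℝ) →ₗ[ℝ] ℝ :=
      { toFun := fun u => hyperplaneChart (k + 2) 0 u i - ε * hyperplaneChart (k + 2) 0 u l
        map_add' := fun u v => by
          simp only [hyperplaneChart_add, PiLp.add_apply]; ring
        map_smul' := fun a u => by
          simp only [hyperplaneChart_smul, PiLp.smul_apply, smul_eq_mul, RingHom.id_apply]; ring }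
    have hset : hyperplaneChart (k + 2) 0 ⁻¹' {x | x i = ε * x l} = (LinearMap.ker f : Set _) := by
      ext u
      exact sub_eq_zero.symm
    rw [hset]
    refine Measure.addHaar_submodule _ _ fun htop => ?_
    obtain ⟨m, hmi, hml⟩ : ∃ m, m ≠ i ∧ m ≠ l := by
      obtain ⟨m, hm⟩ : (({i, l} : Finset (Fin (k + 3)))ᶜ).Nonempty := by
        rw [← Finset.card_pos, Finset.card_compl, Fintype.card_fin, Finset.card_pair hil]
        omega
      simp only [Finset.mem_compl, Finset.mem_insert, Finset.mem_singleton, not_or] at hm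
      exact ⟨m, hm⟩
    let x : EuclideanSpace ℝ (Fin (k + 3)) := WithLp.toLp 2 (Pi.single i 1 - Pi.single m 1)
    have hx : x ∈ (Submodule.span ℝ {ones (k + 3)})ᗮ := mem_orthogonal_span_ones.2 (by simp [x])
    have hxu : hyperplaneChart (k + 2) 0 ((linearChart (k + 2)).symm ⟨x, hx⟩) = x :=
      congrArg Subtype.val ((linearChart (k + 2)).apply_symm_apply ⟨x, hx⟩)
    have h0 : f ((linearChart (k + 2)).symm ⟨x, hx⟩) = 0 :=
      LinearMap.mem_ker.1 (htop ▸ Submodule.mem_top)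
    have h1 : x i - ε * x l = 0 := by rw [← hxu]; exact h0
    simp [x, hmi.symm, hil.symm, hml.symm] at h1
  refine measure_mono_null (t := {x | x i = 1 * x l} ∪ {x | x i = (-1) * x l}) ?_
    (measure_union_null (key 1) (key (-1)))
  intro x hx
  rcases abs_eq_abs.1 hx with h | h
  · left; simpa using h
  · right; simpa using h

lemma exists_perm_zero_one {k : ℕ} {i j : Fin (k + 2)} (hij : i ≠ j) :
    ∃ e : Equiv.Perm (Fin (k + 2)), e 0 = i ∧ e 1 = j := by
  have h : (Equiv.swap 0 i).symm j ≠ 0 := by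
    rw [Ne, Equiv.symm_apply_eq, Equiv.swap_apply_left]
    exact hij.symm
  refine ⟨(Equiv.swap 1 ((Equiv.swap 0 i).symm j)).trans (Equiv.swap 0 i), ?_, ?_⟩
  · rw [Equiv.trans_apply, Equiv.swap_apply_of_ne_of_ne (by simp) h.symm, Equiv.swap_apply_left]
  · rw [Equiv.trans_apply, Equiv.swap_apply_left, Equiv.apply_symm_apply]

/-- The total mass of the slice, in chart coordinates. -/
def sliceMass (k : ℕ) : ℝ≥0∞ := ∫⁻ y in Icc 0 1, sliceWeight k y

/-- Polar coordinates for the sup norm on the hyperplane. -/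
theorem lintegral_supNorm_abs_apply (k : ℕ) {φ : ℝ → ℝ → ℝ≥0∞}
    (hφ : Measurable (Function.uncurry φ)) (j : Fin (k + 3)) :
    ∫⁻ x, φ (supNorm x) |x j| ∂(chartMeasure (k + 2) 0) =
      2 * ∫⁻ t in Ioi 0, ENNReal.ofReal (t ^ (k + 1)) *
        (φ t t * sliceMass k + (k + 2) * ∫⁻ y in Icc 0 1, φ t (t * y) * sliceWeight k y) := by
  have hcover : (⋃ i : Fin (k + 3), dominantCone i) = univ := by
    refine eq_univ_of_forall fun x => mem_iUnion.2 ?_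
    obtain ⟨i, hi⟩ := Finite.exists_max fun i => |x i|
    exact ⟨i, hi⟩
  have hdisj : Pairwise (Function.onFun (AEDisjoint (chartMeasure (k + 2) 0))
      (dominantCone : Fin (k + 3) → _)) := by
    intro i l hil
    refine measure_mono_null ?_ (chartMeasure_setOf_abs_eq k hil)
    rintro x ⟨hi, hl⟩
    exact le_antisymm (hl i) (hi l)
  have hdiag : Measurable (Function.uncurry fun a _ : ℝ => φ a a) :=
    hφ.comp (measurable_fst.prodMk measurable_fst)
  -- On the cone of `j` itself `|x j|` is the norm; the other `k + 2` cones contribute equally.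
  have hcone : ∀ i, ∫⁻ x in dominantCone i, φ (supNorm x) |x j| ∂(chartMeasure (k + 2) 0) =
      if i = j then ∫⁻ x in dominantCone 0, φ |x 0| |x 0| ∂(chartMeasure (k + 2) 0)
      else ∫⁻ x in dominantCone 0, φ |x 0| |x 1| ∂(chartMeasure (k + 2) 0) := by
    intro i
    rw [setLIntegral_congr_fun (g := fun x => φ |x i| |x j|) (measurableSet_dominantCone i)
      fun x hx => by simp only [supNorm_eq_of_mem_dominantCone hx]]
    split_ifs with hij
    · subst hij
      have := lintegral_dominantCone_perm 0 (Equiv.swap 0 i) hφ 0 0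
      simpa using this
    · obtain ⟨e, he0, he1⟩ := exists_perm_zero_one hij
      have := lintegral_dominantCone_perm 0 e hφ 0 1
      rwa [he0, he1] at this
  rw [← setLIntegral_univ, ← hcover, lintegral_iUnion₀
    (fun i => (measurableSet_dominantCone i).nullMeasurableSet) hdisj, tsum_fintype]
  simp_rw [hcone]
  rw [Finset.sum_ite, Finset.sum_const, Finset.sum_const, Finset.filter_eq', Finset.filter_ne']
  simp only [Finset.mem_univ, if_true, Finset.card_singleton, one_smul, Finset.card_erase_of_mem,
    Finset.card_univ, Fintype.card_fin]
  rw [lintegral_dominantCone k hφ, lintegral_dominantCone k hdiag, nsmul_eq_mul,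
    mul_left_comm, ← mul_add]
  have hH := measurable_lintegral_mul_sliceWeight k hφ
  have hsw := measurable_sliceWeight k
  rw [← lintegral_const_mul _ (by fun_prop), ← lintegral_add_right _ (by fun_prop)]
  congr 1
  refine lintegral_congr fun t => ?_
  rw [lintegral_const_mul _ hsw, sliceMass, mul_add]
  congr 1
  rw [mul_left_comm]
  congr 2
  norm_num

/-! ### The distribution function of the slice -/

lemma volume_setOf_forall_mem_Icc_lt_top (k : ℕ) :
    volume {w : Fin k → ℝ | ∀ i, w i ∈ Icc (-1 : ℝ) 1} < ∞ := by
  refine (measure_mono ?_).trans_lt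
    (isCompact_Icc (a := fun _ : Fin k => (-1 : ℝ)) (b := fun _ => 1)).measure_lt_top
  exact fun w hw => ⟨fun i => (hw i).1, fun i => (hw i).2⟩

lemma sliceWeight_le (k : ℕ) (r : ℝ) :
    sliceWeight k r ≤ volume {w : Fin k → ℝ | ∀ i, w i ∈ Icc (-1 : ℝ) 1} :=
  measure_mono fun _ hw => hw.1

lemma sliceWeight_lt_top (k : ℕ) (r : ℝ) : sliceWeight k r < ∞ :=
  (sliceWeight_le k r).trans_lt (volume_setOf_forall_mem_Icc_lt_top k)

lemma sliceWeight_pos (k : ℕ) {r : ℝ} (hr : r ∈ Icc (0 : ℝ) 1) : 0 < sliceWeight k r := by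
  have hopen : IsOpen (Set.pi univ (fun _ : Fin k => Ioo (-1 : ℝ) 1) ∩
      (fun w : Fin k → ℝ => |r - ∑ i, w i|) ⁻¹' Iio 2) :=
    (isOpen_set_pi finite_univ fun _ _ => isOpen_Ioo).inter (isOpen_Iio.preimage (by fun_prop))
  refine (hopen.measure_pos volume ⟨0, ?_, ?_⟩).trans_le (measure_mono ?_)
  · intro i _; simp
  · simp only [mem_preimage, Pi.zero_apply, Finset.sum_const_zero, sub_zero, mem_Iio]
    rw [abs_of_nonneg hr.1]; linarith [hr.2]
  · rintro w ⟨h1, h2⟩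
    exact ⟨fun i => Ioo_subset_Icc_self (h1 i (mem_univ i)), (mem_Iio.1 h2).le⟩

lemma sliceMass_ne_top (k : ℕ) : sliceMass k ≠ ∞ := by
  refine ((lintegral_mono fun y => sliceWeight_le k y).trans_lt ?_).ne
  rw [lintegral_const]
  exact ENNReal.mul_lt_top (volume_setOf_forall_mem_Icc_lt_top k) (by simp)

lemma sliceMass_ne_zero (k : ℕ) : sliceMass k ≠ 0 := by
  refine ((setLIntegral_pos_iff (measurable_sliceWeight k)).2 ?_).ne'
  refine lt_of_lt_of_le ?_ (measure_mono (μ := volume) (s := Icc (0 : ℝ) 1) ?_)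
  · simp
  · exact fun y hy => ⟨(sliceWeight_pos k hy).ne', hy⟩

/-- Dominated convergence: the indicator can jump at `r` only if `∑ w = r ± 2`, a null condition
when `|r| < 2`. For `k = 0` the weight does jump at `±2`. -/
lemma continuousOn_toReal_sliceWeight (k : ℕ) :
    ContinuousOn (fun r => (sliceWeight k r).toReal) (Ioo (-2) 2) := by
  intro r hr
  refine ContinuousAt.continuousWithinAt ?_
  have hms : ∀ r : ℝ, MeasurableSet {w : Fin k → ℝ | (∀ i, w i ∈ Icc (-1 : ℝ) 1) ∧
      |r - ∑ i, w i| ≤ 2} := fun r =>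
    measurableSet_setOf_and (measurableSet_setOf_forall_mem_Icc k)
      (measurableSet_le (by fun_prop) measurable_const)
  have hrep : (fun r => (sliceWeight k r).toReal) = fun r => ∫ w : Fin k → ℝ,
      {w : Fin k → ℝ | (∀ i, w i ∈ Icc (-1 : ℝ) 1) ∧ |r - ∑ i, w i| ≤ 2}.indicator 1 w := by
    funext r
    rw [integral_indicator_one (hms r)]
    rfl
  rw [hrep]
  refine continuousAt_of_dominated
    (bound := {w : Fin k → ℝ | ∀ i, w i ∈ Icc (-1 : ℝ) 1}.indicator 1)
    (Filter.Eventually.of_forall fun r =>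
      (measurable_one.indicator (hms r)).aestronglyMeasurable) ?_ ?_ ?_
  · refine Filter.Eventually.of_forall fun r => Filter.Eventually.of_forall fun w => ?_
    rw [Real.norm_of_nonneg (indicator_nonneg (f := (1 : (Fin k → ℝ) → ℝ)) (fun _ _ => zero_le_one) w)]
    exact indicator_le_indicator_of_subset (fun w hw => hw.1) (fun _ => zero_le_one) w
  · exact (integrable_indicator_iff (measurableSet_setOf_forall_mem_Icc k)).2
      (integrableOn_const (volume_setOf_forall_mem_Icc_lt_top k).ne)
  · have h1 := volume_setOf_sum_eq (k := k) (c := r - 2) (by linarith [hr.2])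
    have h2 := volume_setOf_sum_eq (k := k) (c := r + 2) (by linarith [hr.1])
    filter_upwards [measure_eq_zero_iff_ae_notMem.1 h1, measure_eq_zero_iff_ae_notMem.1 h2]
      with w hw1 hw2
    have hcont : ContinuousAt (fun r : ℝ => |r - ∑ i, w i|) r := by fun_prop
    have hne : |r - ∑ i, w i| ≠ 2 := by
      intro h
      rcases (abs_eq (by norm_num)).1 h with h | h
      · exact hw1 (show ∑ i, w i = r - 2 by linarith)
      · exact hw2 (show ∑ i, w i = r + 2 by linarith)
    have hev : ∀ᶠ s in nhds r, (|s - ∑ i, w i| ≤ 2 ↔ |r - ∑ i, w i| ≤ 2) := by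
      rcases hne.lt_or_gt with h | h
      · filter_upwards [hcont.eventually_lt continuousAt_const h] with s hs
        exact ⟨fun _ => h.le, fun _ => le_of_lt hs⟩
      · filter_upwards [continuousAt_const.eventually_lt hcont h] with s hs
        exact ⟨fun h' => absurd h' (not_le.2 hs), fun h' => absurd h' (not_le.2 h)⟩
    refine ContinuousAt.congr (f := fun _ => {w : Fin k → ℝ | (∀ i, w i ∈ Icc (-1 : ℝ) 1) ∧
      |r - ∑ i, w i| ≤ 2}.indicator (1 : (Fin k → ℝ) → ℝ) w) continuousAt_const ?_
    filter_upwards [hev] with s hs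
    simp only [indicator, mem_ofPred_eq, hs]
    congr

/-- The density of `|Z_2|`. -/
def sliceDensity (k : ℕ) (r : ℝ) : ℝ := (sliceWeight k r).toReal / (sliceMass k).toReal

lemma sliceDensity_nonneg (k : ℕ) (r : ℝ) : 0 ≤ sliceDensity k r := by
  unfold sliceDensity; positivity

lemma measurable_sliceDensity (k : ℕ) : Measurable (sliceDensity k) :=
  (measurable_sliceWeight k).ennreal_toReal.div_const _

lemma ofReal_sliceDensity (k : ℕ) (r : ℝ) :
    ENNReal.ofReal (sliceDensity k r) = sliceWeight k r / sliceMass k := by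
  rw [sliceDensity, ENNReal.ofReal_div_of_pos
    (ENNReal.toReal_pos (sliceMass_ne_zero k) (sliceMass_ne_top k)),
    ENNReal.ofReal_toReal (sliceWeight_lt_top k r).ne, ENNReal.ofReal_toReal (sliceMass_ne_top k)]

lemma sliceWeight_eq (k : ℕ) (r : ℝ) :
    sliceWeight k r = sliceMass k * ENNReal.ofReal (sliceDensity k r) := by
  rw [ofReal_sliceDensity, ENNReal.mul_div_cancel (sliceMass_ne_zero k) (sliceMass_ne_top k)]

lemma lintegral_sliceDensity (k : ℕ) :
    ∫⁻ y in Icc 0 1, ENNReal.ofReal (sliceDensity k y) = 1 := by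
  simp_rw [ofReal_sliceDensity, div_eq_mul_inv]
  rw [lintegral_mul_const _ (measurable_sliceWeight k)]
  exact ENNReal.mul_inv_cancel (sliceMass_ne_zero k) (sliceMass_ne_top k)

lemma continuousOn_sliceDensity (k : ℕ) : ContinuousOn (sliceDensity k) (Ioo (-2) 2) :=
  (continuousOn_toReal_sliceWeight k).div_const _

lemma Icc_zero_one_subset_Ioo : Icc (0 : ℝ) 1 ⊆ Ioo (-2) 2 :=
  fun _ hx => ⟨by linarith [hx.1], by linarith [hx.2]⟩

lemma sliceCDF_eq_integral (k : ℕ) (hn : 3 ≤ k + 3) {r : ℝ} (hr : r ∈ Icc (0 : ℝ) 1) :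
    sliceCDF (k + 3) hn r = ∫ y in (0 : ℝ)..r, sliceDensity k y := by
  obtain ⟨κ, hκ, h⟩ := exists_hyperplaneVolume_eq_smul_chartMeasure (k + 1)
  have hκ' : (κ : ℝ≥0∞) ≠ 0 := by exact_mod_cast hκ
  have hmass : chartMeasure (k + 1) (-1) (cube (k + 2)) = sliceMass k := by
    have := lintegral_cube_chartMeasure k (ψ := fun _ => 1) measurable_const
    simpa [sliceMass] using this
  have hset : MeasurableSet {z : EuclideanSpace ℝ (Fin (k + 2)) | |z 0| ≤ r} :=
    measurableSet_le (by fun_prop) measurable_const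
  have hpart : chartMeasure (k + 1) (-1) (cube (k + 2) ∩ {z | |z 0| ≤ r}) =
      ∫⁻ y in Icc 0 r, sliceWeight k y := by
    have := lintegral_cube_chartMeasure k (ψ := (Iic r).indicator fun _ => 1)
      (measurable_const.indicator measurableSet_Iic)
    rw [← lintegral_indicator measurableSet_Icc] at this ⊢
    rw [inter_comm, ← Measure.restrict_apply hset, ← lintegral_indicator_one hset]
    refine (Eq.trans ?_ this).trans ?_
    · rfl
    · refine lintegral_congr fun y => ?_
      by_cases hy : y ∈ Icc 0 r
      · rw [indicator_of_mem hy, indicator_of_mem (mem_Icc.2 ⟨hy.1, hy.2.trans hr.2⟩),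
          indicator_of_mem (mem_Iic.2 hy.2), one_mul]
      · rw [indicator_of_notMem hy]
        by_cases hy' : y ∈ Icc (0 : ℝ) 1
        · rw [indicator_of_mem hy', indicator_of_notMem (mt mem_Iic.1 fun h' => hy ⟨hy'.1, h'⟩), zero_mul]
        · rw [indicator_of_notMem hy']
  have hlaw : sliceLaw (k + 3) {z | |z ⟨0, by omega⟩| ≤ r} =
      ∫⁻ y in Icc 0 r, ENNReal.ofReal (sliceDensity k y) := by
    change cond (hyperplaneVolume (k + 2) (-1)) (cube (k + 2)) {z | |z 0| ≤ r} = _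
    -- The ratio `κ` cancels between the mass of the event and that of the slice.
    rw [cond_apply (measurableSet_cube _), h, Measure.smul_apply, Measure.smul_apply, hmass, hpart]
    simp_rw [ofReal_sliceDensity, div_eq_mul_inv]
    rw [lintegral_mul_const _ (measurable_sliceWeight k), ENNReal.smul_def, ENNReal.smul_def,
      smul_eq_mul, smul_eq_mul, ENNReal.mul_inv (Or.inl hκ') (Or.inl ENNReal.coe_ne_top),
      mul_mul_mul_comm, ENNReal.inv_mul_cancel hκ' ENNReal.coe_ne_top, one_mul, mul_comm]
  rw [sliceCDF, Measure.real, hlaw, intervalIntegral.integral_of_le hr.1,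
    ← integral_Icc_eq_integral_Ioc,
    integral_eq_lintegral_of_nonneg_ae (Filter.Eventually.of_forall (sliceDensity_nonneg k))
      (measurable_sliceDensity k).aestronglyMeasurable]

/-- The density is continuous on a neighbourhood of `[0, 1]`, so its integral has a two-sided
derivative even at the end points; the restriction to `[0, 1]` enters because the distribution
function is identified with that integral only there. -/
lemma hasDerivWithinAt_sliceCDF (k : ℕ) (hn : 3 ≤ k + 3) {r : ℝ} (hr : r ∈ Icc (0 : ℝ) 1) :
    HasDerivWithinAt (sliceCDF (k + 3) hn) (sliceDensity k r) (Icc 0 1) r := by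
  have hc := continuousOn_sliceDensity k
  have hd : HasDerivAt (fun r => ∫ y in (0 : ℝ)..r, sliceDensity k y) (sliceDensity k r) r := by
    refine intervalIntegral.integral_hasDerivAt_right ?_
      (hc.stronglyMeasurableAtFilter isOpen_Ioo r (Icc_zero_one_subset_Ioo hr))
      (hc.continuousAt (isOpen_Ioo.mem_nhds (Icc_zero_one_subset_Ioo hr)))
    refine (hc.mono ?_).intervalIntegrable
    rw [uIcc_of_le hr.1]
    exact (Icc_subset_Icc_right hr.2).trans Icc_zero_one_subset_Ioo
  exact hd.hasDerivWithinAt.congr (fun x hx => sliceCDF_eq_integral k hn hx)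
    (sliceCDF_eq_integral k hn hr)

lemma derivWithin_sliceCDF (k : ℕ) (hn : 3 ≤ k + 3) {r : ℝ} (hr : r ∈ Icc (0 : ℝ) 1) :
    derivWithin (sliceCDF (k + 3) hn) (Icc 0 1) r = sliceDensity k r :=
  (hasDerivWithinAt_sliceCDF k hn hr).derivWithin (uniqueDiffOn_Icc zero_lt_one r hr)

/-! ### The distribution of one coordinate -/

/-- The ratio between the hyperplane volume and `chartMeasure`. -/
def chartRatio (m : ℕ) : ℝ≥0 := (exists_hyperplaneVolume_eq_smul_chartMeasure m).choose

lemma chartRatio_ne_zero (m : ℕ) : chartRatio m ≠ 0 :=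
  (exists_hyperplaneVolume_eq_smul_chartMeasure m).choose_spec.1

lemma hyperplaneVolume_eq_smul (m : ℕ) (c : ℝ) :
    hyperplaneVolume (m + 1) c = chartRatio m • chartMeasure m c :=
  (exists_hyperplaneVolume_eq_smul_chartMeasure m).choose_spec.2 c

lemma mem_cube_iff {m : ℕ} (x : EuclideanSpace ℝ (Fin m)) : x ∈ cube m ↔ supNorm x ≤ 1 := by
  rw [supNorm, pi_norm_le_iff_of_nonneg zero_le_one]
  simp [cube, abs_le]

lemma supNorm_neg {m : ℕ} (x : EuclideanSpace ℝ (Fin m)) : supNorm (-x) = supNorm x :=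
  norm_neg (WithLp.ofLp x : Fin m → ℝ)

lemma ae_chartMeasure_sum_eq (m : ℕ) (c : ℝ) : ∀ᵐ x ∂chartMeasure m c, ∑ i, x i = c := by
  rw [chartMeasure, ae_map_iff (measurable_hyperplaneChart m c).aemeasurable
    (measurableSet_eq_fun (by fun_prop) measurable_const)]
  exact Filter.Eventually.of_forall (sum_hyperplaneChart m c)

lemma hyperplaneVolume_restrict_balancedPolytope (m : ℕ) :
    (hyperplaneVolume (m + 1) 0).restrict (balancedPolytope (m + 1)) =
      chartRatio m • (chartMeasure m 0).restrict (cube (m + 1)) := by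
  rw [hyperplaneVolume_eq_smul, Measure.restrict_smul]
  congr 1
  refine Measure.restrict_congr_set ?_
  filter_upwards [ae_chartMeasure_sum_eq m 0] with x hx
  exact propext ⟨fun h => h.1, fun h => ⟨h, hx⟩⟩

/-- The value of the normalising constant `(n - 1) V_{n-1}`. -/
lemma polytopeVolume_eq (k : ℕ) : (((k + 3 : ℕ) : ℝ) - 1) * polytopeVolume (k + 3) =
    2 * chartRatio (k + 2) * (sliceMass k).toReal * (k + 3) := by
  -- The polar formula applied to the indicator of `t ≤ 1` gives the volume; `∫_0^1 t^(k+1) dt =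
  -- 1/(k+2)` then cancels the factor `n - 1`.
  have hφ : Measurable (Function.uncurry fun t _ : ℝ => (Iic (1 : ℝ)).indicator (1 : ℝ → ℝ≥0∞) t) :=
    (measurable_one.indicator measurableSet_Iic).comp measurable_fst
  have h1 := lintegral_supNorm_abs_apply k hφ 0
  have h2 : ∫⁻ x, (Iic (1 : ℝ)).indicator (1 : ℝ → ℝ≥0∞) (supNorm x) ∂chartMeasure (k + 2) 0 =
      chartMeasure (k + 2) 0 (cube (k + 3)) := by
    rw [← lintegral_indicator_one (measurableSet_cube _)]
    refine lintegral_congr fun x => ?_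
    by_cases hx : x ∈ cube (k + 3)
    · rw [indicator_of_mem hx, indicator_of_mem (mem_Iic.2 ((mem_cube_iff x).1 hx))]; rfl
    · rw [indicator_of_notMem hx, indicator_of_notMem (mt mem_Iic.1 (mt (mem_cube_iff x).2 hx))]
  have h3 : ∫⁻ t in Ioi (0 : ℝ), ENNReal.ofReal (t ^ (k + 1)) *
      ((Iic (1 : ℝ)).indicator (1 : ℝ → ℝ≥0∞) t * sliceMass k + (k + 2) *
        ∫⁻ y in Icc (0 : ℝ) 1, (Iic (1 : ℝ)).indicator (1 : ℝ → ℝ≥0∞) t * sliceWeight k y) =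
      ENNReal.ofReal (1 / (k + 2)) * ((k + 3) * sliceMass k) := by
    have hint : ∫⁻ t in Ioc (0 : ℝ) 1, ENNReal.ofReal (t ^ (k + 1)) =
        ENNReal.ofReal (1 / (k + 2)) := by
      rw [← ofReal_integral_eq_lintegral_ofReal, ← intervalIntegral.integral_of_le zero_le_one,
        integral_pow]
      · congr 1; push_cast; simp; ring
      · exact (intervalIntegrable_iff_integrableOn_Ioc_of_le zero_le_one).1
          ((continuous_pow _).intervalIntegrable _ _)
      · exact (ae_restrict_mem measurableSet_Ioc).mono fun t ht => pow_nonneg ht.1.le _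
    rw [← hint, ← lintegral_mul_const _ (by fun_prop), ← lintegral_indicator measurableSet_Ioi,
      ← lintegral_indicator measurableSet_Ioc]
    refine lintegral_congr fun t => ?_
    by_cases h0 : 0 < t
    · rw [indicator_of_mem (mem_Ioi.2 h0), lintegral_const_mul _ (measurable_sliceWeight k)]
      by_cases h1 : t ≤ 1
      · rw [indicator_of_mem (mem_Ioc.2 ⟨h0, h1⟩), indicator_of_mem (mem_Iic.2 h1), ← sliceMass]
        simp only [Pi.one_apply, one_mul]
        rw [← one_add_mul]
        congr 2
        ring
      · rw [indicator_of_notMem (mt mem_Iic.1 h1), indicator_of_notMem fun h => h1 (mem_Ioc.1 h).2]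
        simp
    · rw [indicator_of_notMem (mt mem_Ioi.1 h0), indicator_of_notMem fun h => h0 (mem_Ioc.1 h).1]
  have h4 := congrArg (fun μ => μ univ) (hyperplaneVolume_restrict_balancedPolytope (k + 2))
  simp only [Measure.restrict_apply_univ, Measure.smul_apply] at h4
  rw [polytopeVolume, Measure.real, h4, ← h2, h1, h3]
  rw [ENNReal.smul_def, smul_eq_mul, ENNReal.toReal_mul, ENNReal.toReal_mul, ENNReal.toReal_mul,
    ENNReal.toReal_mul, ENNReal.toReal_ofReal (by positivity)]
  have h5 : ((k : ℝ≥0∞) + 3).toReal = k + 3 := by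
    rw [ENNReal.toReal_add (by simp) (by simp)]; simp
  rw [h5, ENNReal.coe_toReal]
  push_cast
  have : (k + 2 : ℝ) ≠ 0 := by positivity
  simp only [ENNReal.toReal_ofNat]
  field_simp
  ring

/-- The density of `law (k + 3) g` relative to `chartMeasure (k + 2) 0`, as a function of the sup
norm. -/
def radialDensity (k : ℕ) (g : ℝ → ℝ) (t : ℝ) : ℝ≥0∞ :=
  (Iic (1 : ℝ)).indicator (fun t => chartRatio (k + 2) *
    ENNReal.ofReal (g t / ((((k + 3 : ℕ) : ℝ) - 1) * polytopeVolume (k + 3) * t ^ (k + 1)))) t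

lemma measurable_radialDensity (k : ℕ) {g : ℝ → ℝ} (hg : Measurable g) :
    Measurable (radialDensity k g) :=
  Measurable.indicator (by fun_prop) measurableSet_Iic

lemma lintegral_law (k : ℕ) {g : ℝ → ℝ} (hg : Measurable g)
    {F : EuclideanSpace ℝ (Fin (k + 3)) → ℝ≥0∞} (hF : Measurable F) :
    ∫⁻ x, F x ∂(law (k + 3) g) =
      ∫⁻ x, radialDensity k g (supNorm x) * F x ∂(chartMeasure (k + 2) 0) := by
  have hs := measurable_supNorm (m := k + 3)
  have hd : Measurable fun x => ENNReal.ofReal (density (k + 3) g x) :=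
    ENNReal.measurable_ofReal.comp ((hg.comp hs).div (measurable_const.mul (hs.pow_const _)))
  rw [law, lintegral_withDensity_eq_lintegral_mul _ hd hF,
    hyperplaneVolume_restrict_balancedPolytope (k + 2), lintegral_smul_measure,
    ← lintegral_indicator (measurableSet_cube _), ENNReal.smul_def, smul_eq_mul,
    ← lintegral_const_mul _ ((hd.mul hF).indicator (measurableSet_cube _))]
  refine lintegral_congr fun x => ?_
  by_cases hx : x ∈ cube (k + 3)
  · rw [indicator_of_mem hx, radialDensity, indicator_of_mem (mem_Iic.2 ((mem_cube_iff x).1 hx)),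
      Pi.mul_apply, mul_assoc]
    rfl
  · rw [indicator_of_notMem hx, radialDensity,
      indicator_of_notMem (mt mem_Iic.1 (mt (mem_cube_iff x).2 hx)), zero_mul, mul_zero]

lemma lintegral_law_neg (k : ℕ) {g : ℝ → ℝ} (hg : Measurable g)
    {F : EuclideanSpace ℝ (Fin (k + 3)) → ℝ≥0∞} (hF : Measurable F) :
    ∫⁻ x, F (-x) ∂(law (k + 3) g) = ∫⁻ x, F x ∂(law (k + 3) g) := by
  have h := ((measurable_radialDensity k hg).comp measurable_supNorm).mul hF
  rw [lintegral_law k hg hF, lintegral_law k hg (F := fun x => F (-x)) (hF.comp measurable_neg),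
    ← lintegral_neg_chartMeasure (F := fun x => radialDensity k g (supNorm x) * F x) h]
  simp only [supNorm_neg]

/-- The mixture description of `|X_j|`: either the radius itself, or the radius times an independent
copy of `|Z_2|`. -/
lemma lintegral_law_abs_apply (k : ℕ) {g : ℝ → ℝ} (hg : Measurable g) {F : ℝ → ℝ≥0∞}
    (hF : Measurable F) (j : Fin (k + 3)) :
    ∫⁻ x, F |x j| ∂(law (k + 3) g) =
      (k + 3 : ℝ≥0∞)⁻¹ * ∫⁻ t in Ioc 0 1, ENNReal.ofReal (g t) *
        (F t + (k + 2) * ∫⁻ y in Icc 0 1, F (t * y) * ENNReal.ofReal (sliceDensity k y)) := by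
  have hr := measurable_radialDensity k hg
  have hp := measurable_sliceDensity k
  have hφ : Measurable (Function.uncurry fun t a : ℝ => radialDensity k g t * F a) :=
    (hr.comp measurable_fst).mul (hF.comp measurable_snd)
  have hFin : Measurable fun t : ℝ =>
      ∫⁻ y in Icc 0 1, F (t * y) * ENNReal.ofReal (sliceDensity k y) := by
    have h : Measurable fun p : ℝ × ℝ => F (p.1 * p.2) * ENNReal.ofReal (sliceDensity k p.2) := by
      fun_prop
    exact h.lintegral_prod_right'
  have hM : Measurable fun t : ℝ => ENNReal.ofReal (t ^ (k + 1)) *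
      (radialDensity k g t * F t * sliceMass k + (k + 2) *
        ∫⁻ y in Icc 0 1, radialDensity k g t * F (t * y) * sliceWeight k y) := by
    have hms : Measurable fun t : ℝ => ∫⁻ y in Icc 0 1,
        radialDensity k g t * F (t * y) * sliceWeight k y :=
      measurable_lintegral_mul_sliceWeight k hφ
    fun_prop
  rw [lintegral_law k hg (F := fun x => F |x j|) (hF.comp (by fun_prop)),
    lintegral_supNorm_abs_apply k hφ j, ← lintegral_const_mul _ hM,
    ← lintegral_indicator measurableSet_Ioc, ← lintegral_indicator measurableSet_Ioi,
    ← lintegral_const_mul _ (Measurable.indicator (by fun_prop) measurableSet_Ioc)]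
  refine lintegral_congr fun t => ?_
  by_cases h0 : 0 < t
  · rw [indicator_of_mem (mem_Ioi.2 h0)]
    by_cases h1 : t ≤ 1
    · rw [indicator_of_mem (mem_Ioc.2 ⟨h0, h1⟩)]
      have hinner : ∫⁻ y in Icc 0 1, radialDensity k g t * F (t * y) * sliceWeight k y =
          radialDensity k g t * sliceMass k *
            ∫⁻ y in Icc 0 1, F (t * y) * ENNReal.ofReal (sliceDensity k y) := by
        rw [← lintegral_const_mul _ (by fun_prop)]
        refine lintegral_congr fun y => ?_
        rw [sliceWeight_eq]; ring
      -- The Jacobian cancels the power of `t` in the density, and `polytopeVolume_eq` removes every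
      -- other constant but `1/n`.
      have hconst : 2 * ENNReal.ofReal (t ^ (k + 1)) * radialDensity k g t * sliceMass k =
          (k + 3 : ℝ≥0∞)⁻¹ * ENNReal.ofReal (g t) := by
        have hκ : 0 < (chartRatio (k + 2) : ℝ) :=
          lt_of_le_of_ne (chartRatio (k + 2)).2 (by exact_mod_cast (chartRatio_ne_zero _).symm)
        have hW := ENNReal.toReal_pos (sliceMass_ne_zero k) (sliceMass_ne_top k)
        have hpow : 0 < t ^ (k + 1) := by positivity
        rw [radialDensity, indicator_of_mem (mem_Iic.2 h1), polytopeVolume_eq]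
        have e1 : (2 : ℝ≥0∞) = ENNReal.ofReal 2 := by simp
        have e2 : (chartRatio (k + 2) : ℝ≥0∞) = ENNReal.ofReal (chartRatio (k + 2)) := by simp
        have e3 : sliceMass k = ENNReal.ofReal (sliceMass k).toReal :=
          (ENNReal.ofReal_toReal (sliceMass_ne_top k)).symm
        have e4 : (k + 3 : ℝ≥0∞)⁻¹ = ENNReal.ofReal ((k + 3 : ℝ)⁻¹) := by
          rw [ENNReal.ofReal_inv_of_pos (by positivity), ENNReal.ofReal_add (by positivity)
            (by positivity)]
          simp
        rw [e1, e2, e3, e4, ENNReal.toReal_ofReal hW.le, ← ENNReal.ofReal_mul (by positivity),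
          ← ENNReal.ofReal_mul (by positivity), ← ENNReal.ofReal_mul (by positivity), mul_comm,
          ← ENNReal.ofReal_mul (by positivity), ← ENNReal.ofReal_mul (by positivity)]
        congr 1
        field_simp
      rw [hinner, ← mul_assoc ((k + 3 : ℝ≥0∞)⁻¹), ← hconst]
      ring
    · rw [indicator_of_notMem fun h => h1 (mem_Ioc.1 h).2]
      have : radialDensity k g t = 0 := indicator_of_notMem (mt mem_Iic.1 h1) _
      simp [this]
  · rw [indicator_of_notMem (mt mem_Ioi.1 h0), indicator_of_notMem fun h => h0 (mem_Ioc.1 h).1,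
      mul_zero]

/-- By the polar formula, a null set of radii corresponds to a null set of vectors. This permits
replacing `g` by a measurable representative. -/
lemma law_congr (k : ℕ) {g g' : ℝ → ℝ} (h : g =ᵐ[volume.restrict (Icc 0 1)] g') :
    law (k + 3) g = law (k + 3) g' := by
  rw [law, law]
  refine withDensity_congr_ae ?_
  rw [hyperplaneVolume_restrict_balancedPolytope (k + 2)]
  refine (Measure.smul_absolutelyContinuous (c := chartRatio (k + 2))).ae_le ?_
  rw [Filter.EventuallyEq, ae_restrict_iff' measurableSet_Icc] at h
  obtain ⟨N, hsub, hNm, hN⟩ := exists_measurable_superset_of_null (ae_iff.1 h)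
  have hφ : Measurable (Function.uncurry fun t _ : ℝ => N.indicator (1 : ℝ → ℝ≥0∞) t) :=
    (measurable_one.indicator hNm).comp measurable_fst
  have hnull : ∫⁻ x, N.indicator (1 : ℝ → ℝ≥0∞) (supNorm x) ∂chartMeasure (k + 2) 0 = 0 := by
    rw [lintegral_supNorm_abs_apply k hφ 0, lintegral_congr_ae (g := 0), Pi.zero_def,
      lintegral_zero, mul_zero]
    filter_upwards [ae_restrict_of_ae (measure_eq_zero_iff_ae_notMem.1 hN)] with t ht
    simp [ht]
  rw [lintegral_eq_zero_iff (f := fun x => N.indicator (1 : ℝ → ℝ≥0∞) (supNorm x))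
    ((measurable_one.indicator hNm).comp measurable_supNorm)] at hnull
  refine (ae_restrict_iff' (measurableSet_cube _)).2 ?_
  filter_upwards [hnull] with x hx hxc
  have hxN : supNorm x ∉ N := fun hmem => by simp [hmem] at hx
  have hgg : g (supNorm x) = g' (supNorm x) := by
    by_contra hne
    refine hxN (hsub fun hi => hne (hi ⟨norm_nonneg _, (mem_cube_iff x).1 hxc⟩))
  simp only [density, hgg]

/-! ### Laplace integrals on the unit interval -/

lemma image_exp_neg_Ici : (fun t : ℝ => Real.exp (-t)) '' Ici 0 = Ioc 0 1 := by
  ext r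
  constructor
  · rintro ⟨t, ht, rfl⟩
    exact ⟨Real.exp_pos _, Real.exp_le_one_iff.2 (neg_nonpos.2 ht)⟩
  · rintro ⟨h0, h1⟩
    exact ⟨-Real.log r, neg_nonneg.2 (Real.log_nonpos h0.le h1), by simp [Real.exp_log h0]⟩

/-- Shaped for the substitution `r = e^(-t)`: one factor `e^(-t)` is the Jacobian, which leaves
`r^(s-1)`. -/
lemma laplace_integrand_eq (f : ℝ → ℝ) (s : ℝ) :
    (fun t : ℝ => Real.exp (-s * t) * (heaviside t * f (Real.exp (-t)))) =
      (Ici 0).indicator fun t => |-Real.exp (-t)| •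
        ((Real.exp (-t)) ^ (s - 1) * f (Real.exp (-t))) := by
  funext t
  by_cases ht : 0 ≤ t
  · rw [indicator_of_mem (mem_Ici.2 ht), heaviside, if_pos ht, one_mul, abs_neg,
      abs_of_pos (Real.exp_pos _), smul_eq_mul, ← mul_assoc, ← Real.exp_mul, ← Real.exp_add]
    ring_nf
  · rw [indicator_of_notMem (mt mem_Ici.1 ht), heaviside, if_neg ht, zero_mul, mul_zero]

lemma hasDerivWithinAt_exp_neg (t : ℝ) :
    HasDerivWithinAt (fun t : ℝ => Real.exp (-t)) (-Real.exp (-t)) (Ici 0) t := by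
  simpa using ((hasDerivAt_neg t).exp).hasDerivWithinAt

lemma injOn_exp_neg : InjOn (fun t : ℝ => Real.exp (-t)) (Ici 0) :=
  fun _ _ _ _ h => neg_injective (Real.exp_injective h)

lemma laplaceConverges_iff (f : ℝ → ℝ) (s : ℝ) :
    LaplaceConverges (fun t => heaviside t * f (Real.exp (-t))) s ↔
      IntegrableOn (fun r => r ^ (s - 1) * f r) (Ioc 0 1) := by
  rw [LaplaceConverges, laplace_integrand_eq, integrable_indicator_iff measurableSet_Ici,
    ← image_exp_neg_Ici, integrableOn_image_iff_integrableOn_abs_deriv_smul measurableSet_Ici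
      (fun t _ => hasDerivWithinAt_exp_neg t) injOn_exp_neg]

lemma laplace_eq_integral (f : ℝ → ℝ) (s : ℝ) :
    laplace (fun t => heaviside t * f (Real.exp (-t))) s =
      ∫ r in Ioc 0 1, r ^ (s - 1) * f r := by
  rw [laplace, laplace_integrand_eq, integral_indicator measurableSet_Ici,
    ← image_exp_neg_Ici, integral_image_eq_integral_abs_deriv_smul measurableSet_Ici
      (fun t _ => hasDerivWithinAt_exp_neg t) injOn_exp_neg]

/-- The (possibly infinite) moment `∫_0^1 r^(s-1) f(r) dr` of a density. -/
def unitMoment (f : ℝ → ℝ) (s : ℝ) : ℝ≥0∞ :=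
  ∫⁻ r in Ioc 0 1, ENNReal.ofReal (r ^ (s - 1)) * ENNReal.ofReal (f r)

lemma unitMoment_eq_lintegral (f : ℝ → ℝ) (s : ℝ) :
    unitMoment f s = ∫⁻ r in Ioc 0 1, ENNReal.ofReal (r ^ (s - 1) * f r) :=
  setLIntegral_congr_fun measurableSet_Ioc fun _ hr =>
    (ENNReal.ofReal_mul (Real.rpow_nonneg hr.1.le _)).symm

lemma laplaceConverges_iff_unitMoment {f : ℝ → ℝ}
    (hm : AEStronglyMeasurable f (volume.restrict (Ioc 0 1)))
    (h0 : ∀ r ∈ Ioc (0 : ℝ) 1, 0 ≤ f r) (s : ℝ) :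
    LaplaceConverges (fun t => heaviside t * f (Real.exp (-t))) s ↔ unitMoment f s < ∞ := by
  have hm' : AEStronglyMeasurable (fun r => r ^ (s - 1) * f r) (volume.restrict (Ioc 0 1)) :=
    (Measurable.aestronglyMeasurable (by fun_prop)).mul hm
  have hnn : 0 ≤ᵐ[volume.restrict (Ioc (0 : ℝ) 1)] fun r => r ^ (s - 1) * f r :=
    (ae_restrict_mem measurableSet_Ioc).mono fun r hr =>
      mul_nonneg (Real.rpow_nonneg hr.1.le _) (h0 r hr)
  rw [laplaceConverges_iff, unitMoment_eq_lintegral, ← hasFiniteIntegral_iff_ofReal hnn]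
  exact ⟨fun h => h.2, fun h => ⟨hm', h⟩⟩

lemma laplace_eq_toReal_unitMoment {f : ℝ → ℝ}
    (hm : AEStronglyMeasurable f (volume.restrict (Ioc 0 1)))
    (h0 : ∀ r ∈ Ioc (0 : ℝ) 1, 0 ≤ f r) (s : ℝ) :
    laplace (fun t => heaviside t * f (Real.exp (-t))) s = (unitMoment f s).toReal := by
  have hm' : AEStronglyMeasurable (fun r => r ^ (s - 1) * f r) (volume.restrict (Ioc 0 1)) :=
    (Measurable.aestronglyMeasurable (by fun_prop)).mul hm
  have hnn : 0 ≤ᵐ[volume.restrict (Ioc (0 : ℝ) 1)] fun r => r ^ (s - 1) * f r :=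
    (ae_restrict_mem measurableSet_Ioc).mono fun r hr =>
      mul_nonneg (Real.rpow_nonneg hr.1.le _) (h0 r hr)
  rw [laplace_eq_integral, unitMoment_eq_lintegral, integral_eq_lintegral_of_nonneg_ae hnn hm']

lemma lintegral_rpow_sub_one {s : ℝ} (hs : 0 < s) :
    ∫⁻ r in Ioc (0 : ℝ) 1, ENNReal.ofReal (r ^ (s - 1)) = ENNReal.ofReal (1 / s) := by
  have hi : IntervalIntegrable (fun r : ℝ => r ^ (s - 1)) volume 0 1 :=
    intervalIntegral.intervalIntegrable_rpow' (by linarith)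
  rw [← ofReal_integral_eq_lintegral_ofReal
    ((intervalIntegrable_iff_integrableOn_Ioc_of_le zero_le_one).1 hi)
    ((ae_restrict_mem measurableSet_Ioc).mono fun r hr => Real.rpow_nonneg hr.1.le _),
    ← intervalIntegral.integral_of_le zero_le_one, integral_rpow (Or.inl (by linarith))]
  simp [Real.zero_rpow hs.ne']

lemma unitMoment_sliceDensity_lt_top (k : ℕ) {s : ℝ} (hs : 0 < s) :
    unitMoment (sliceDensity k) s < ∞ := by
  obtain ⟨C, hC⟩ := isCompact_Icc.exists_bound_of_continuousOn
    ((continuousOn_sliceDensity k).mono Icc_zero_one_subset_Ioo)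
  have hle : unitMoment (sliceDensity k) s ≤
      ∫⁻ r in Ioc (0 : ℝ) 1, ENNReal.ofReal (r ^ (s - 1)) * ENNReal.ofReal C := by
    refine setLIntegral_mono' measurableSet_Ioc fun r hr => ?_
    gcongr
    exact (le_abs_self _).trans (hC r (Ioc_subset_Icc_self hr))
  refine hle.trans_lt ?_
  rw [lintegral_mul_const _ (by fun_prop), lintegral_rpow_sub_one hs]
  exact ENNReal.mul_lt_top ENNReal.ofReal_lt_top ENNReal.ofReal_lt_top

/-! ### Measures on the unit interval are determined by their moments -/

/-- Weierstrass: polynomials are uniformly dense in the continuous functions on `[a, b]`, and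
integrals of bounded continuous functions determine a finite measure. -/
lemma ext_of_integral_pow_eq {μ ν : Measure ℝ} [IsFiniteMeasure μ] [IsFiniteMeasure ν]
    {a b : ℝ} (hμ : ∀ᵐ x ∂μ, x ∈ Icc a b) (hν : ∀ᵐ x ∂ν, x ∈ Icc a b)
    (h : ∀ m : ℕ, ∫ x, x ^ m ∂μ = ∫ x, x ^ m ∂ν) : μ = ν := by
  have hint : ∀ (ρ : Measure ℝ) [IsFiniteMeasure ρ], (∀ᵐ x ∂ρ, x ∈ Icc a b) →
      ∀ f : ℝ → ℝ, Continuous f → Integrable f ρ := by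
    intro ρ _ hρ f hf
    obtain ⟨C, hC⟩ := isCompact_Icc.exists_bound_of_continuousOn (hf.continuousOn (s := Icc a b))
    exact Integrable.of_bound hf.aestronglyMeasurable C (hρ.mono fun x hx => hC x hx)
  have hpoly : ∀ p : Polynomial ℝ, ∫ x, p.eval x ∂μ = ∫ x, p.eval x ∂ν := by
    intro p
    simp_rw [Polynomial.eval_eq_sum_range]
    rw [integral_finsetSum _ fun i _ => hint μ hμ _ (by fun_prop),
      integral_finsetSum _ fun i _ => hint ν hν _ (by fun_prop)]
    simp_rw [integral_const_mul, h]
  refine ext_of_forall_integral_eq_of_IsFiniteMeasure fun f => ?_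
  have hclose : ∀ (ρ : Measure ℝ) [IsFiniteMeasure ρ], (∀ᵐ x ∂ρ, x ∈ Icc a b) →
      ∀ (p : Polynomial ℝ) (ε : ℝ), (∀ x ∈ Icc a b, |p.eval x - f x| < ε) →
      |∫ x, p.eval x ∂ρ - ∫ x, f x ∂ρ| ≤ ε * ρ.real univ := by
    intro ρ _ hρ p ε hp
    rw [← integral_sub (hint ρ hρ _ p.continuous) (hint ρ hρ _ f.continuous), ← Real.norm_eq_abs]
    exact norm_integral_le_of_norm_le_const (hρ.mono fun x hx => (hp x hx).le)
  refine eq_of_abs_sub_le_all fun ε hε => ?_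
  -- The `+ 1` keeps the denominator positive when both measures vanish.
  obtain ⟨p, hp⟩ := exists_polynomial_near_of_continuousOn a b f f.continuous.continuousOn
    (ε / (μ.real univ + ν.real univ + 1)) (by positivity)
  have h1 := hclose μ hμ p _ hp
  have h2 := hclose ν hν p _ hp
  rw [hpoly p] at h1
  have hM : 0 < μ.real univ + ν.real univ + 1 := by positivity
  have key : ε / (μ.real univ + ν.real univ + 1) * μ.real univ +
      ε / (μ.real univ + ν.real univ + 1) * ν.real univ ≤ ε := by
    rw [← mul_add, div_mul_eq_mul_div, div_le_iff₀ hM]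
    nlinarith
  rw [abs_le] at h1 h2 ⊢
  constructor <;> linarith [h1.1, h1.2, h2.1, h2.2]

/-! ### The characterisation of random balanced samples -/

lemma measurableSet_balancedPolytope (n : ℕ) : MeasurableSet (balancedPolytope n) :=
  measurableSet_setOf_and (measurableSet_cube n)
    (measurableSet_eq_fun (by fun_prop) measurable_const)

lemma ae_law_mem_balancedPolytope (n : ℕ) (g : ℝ → ℝ) :
    ∀ᵐ x ∂law n g, x ∈ balancedPolytope n :=
  (withDensity_absolutelyContinuous _ _).ae_le
    (ae_restrict_mem (measurableSet_balancedPolytope n))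

/-- Powers are multiplicative, so the moment of the product `R |Z_2|` factors. -/
lemma lintegral_rpow_abs_apply_law (k : ℕ) {g : ℝ → ℝ} (hg : Measurable g) (j : Fin (k + 3))
    (s : ℝ) :
    ∫⁻ x, ENNReal.ofReal (|x j| ^ (s - 1)) ∂(law (k + 3) g) =
      (k + 3 : ℝ≥0∞)⁻¹ * (unitMoment g s * (1 + (k + 2) * unitMoment (sliceDensity k) s)) := by
  have hp := measurable_sliceDensity k
  rw [lintegral_law_abs_apply k hg (F := fun a => ENNReal.ofReal (a ^ (s - 1))) (by fun_prop) j]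
  congr 1
  rw [unitMoment, ← lintegral_mul_const _ (by fun_prop)]
  refine setLIntegral_congr_fun measurableSet_Ioc fun t ht => ?_
  have hinner : ∫⁻ y in Icc 0 1, ENNReal.ofReal ((t * y) ^ (s - 1)) *
      ENNReal.ofReal (sliceDensity k y) =
      ENNReal.ofReal (t ^ (s - 1)) * unitMoment (sliceDensity k) s := by
    rw [setLIntegral_congr Ioc_ae_eq_Icc.symm, unitMoment, ← lintegral_const_mul _ (by fun_prop)]
    refine setLIntegral_congr_fun measurableSet_Ioc fun y hy => ?_
    rw [Real.mul_rpow ht.1.le hy.1.le, ENNReal.ofReal_mul (Real.rpow_nonneg ht.1.le _), mul_assoc]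
  simp only [hinner]
  ring

lemma isProbabilityMeasure_law (k : ℕ) {g : ℝ → ℝ} (hg : Measurable g)
    (h1 : ∫⁻ t in Ioc 0 1, ENNReal.ofReal (g t) = 1) : IsProbabilityMeasure (law (k + 3) g) := by
  constructor
  have h := lintegral_law_abs_apply k hg (F := fun _ => 1) measurable_const 0
  simp only [lintegral_const, one_mul, lintegral_sliceDensity] at h
  rw [lintegral_mul_const _ (by fun_prop), h1, mul_one, one_mul] at h
  rw [h, show (1 + (k + 2) : ℝ≥0∞) = k + 3 by ring]
  exact ENNReal.inv_mul_cancel (by simp) (by finiteness)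

lemma lintegral_cond_Icc {F : ℝ → ℝ≥0∞} (hF : Measurable F) :
    ∫⁻ y, F y ∂(cond volume (Icc (-1 : ℝ) 1)) = 2⁻¹ * ∫⁻ y in Ioc 0 1, (F y + F (-y)) := by
  rw [ProbabilityTheory.cond, lintegral_smul_measure, Real.volume_Icc, smul_eq_mul,
    ← lintegral_indicator measurableSet_Icc,
    lintegral_eq_lintegral_Ioi_add_neg (hF.indicator measurableSet_Icc),
    ← lintegral_indicator measurableSet_Ioi, ← lintegral_indicator measurableSet_Ioc]
  congr 1
  · norm_num
  · refine lintegral_congr fun y => ?_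
    by_cases h0 : 0 < y
    · rw [indicator_of_mem (mem_Ioi.2 h0)]
      by_cases h1 : y ≤ 1
      · rw [indicator_of_mem (mem_Ioc.2 ⟨h0, h1⟩),
          indicator_of_mem (mem_Icc.2 ⟨by linarith, h1⟩),
          indicator_of_mem (mem_Icc.2 ⟨by linarith, by linarith⟩)]
      · rw [indicator_of_notMem fun h => h1 (mem_Icc.1 h).2,
          indicator_of_notMem fun h => h1 (by linarith [(mem_Icc.1 h).1]),
          indicator_of_notMem fun h => h1 (mem_Ioc.1 h).2, add_zero]
    · rw [indicator_of_notMem (mt mem_Ioi.1 h0), indicator_of_notMem fun h => h0 (mem_Ioc.1 h).1]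

/-- A coordinate of `law (k + 3) g` is uniform iff its absolute moments are those of a uniform
random variable. -/
lemma map_apply_law_eq_cond_iff (k : ℕ) {g : ℝ → ℝ} (hg : Measurable g)
    (h1 : ∫⁻ t in Ioc 0 1, ENNReal.ofReal (g t) = 1) (j : Fin (k + 3)) :
    (law (k + 3) g).map (fun x => x j) = cond volume (Icc (-1 : ℝ) 1) ↔
      ∀ s : ℝ, 0 < s → ∫⁻ x, ENNReal.ofReal (|x j| ^ (s - 1)) ∂(law (k + 3) g) =
        ENNReal.ofReal (1 / s) := by
  have hmj : Measurable fun x : EuclideanSpace ℝ (Fin (k + 3)) => x j := by fun_prop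
  constructor
  · intro h s hs
    have hF : Measurable fun y : ℝ => ENNReal.ofReal (|y| ^ (s - 1)) := by fun_prop
    have hmap := lintegral_map (μ := law (k + 3) g) hF hmj
    rw [h, lintegral_cond_Icc hF] at hmap
    rw [← hmap, ← lintegral_rpow_sub_one hs, ← lintegral_const_mul _ (by fun_prop)]
    refine setLIntegral_congr_fun measurableSet_Ioc fun y hy => ?_
    simp only [abs_neg, abs_of_pos hy.1]
    rw [← two_mul, ← mul_assoc, ENNReal.inv_mul_cancel (by norm_num) (by norm_num), one_mul]
  · intro h
    have hprob := isProbabilityMeasure_law k hg h1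
    have hmabs : Measurable fun x : EuclideanSpace ℝ (Fin (k + 3)) => |x j| := by fun_prop
    have habs : (law (k + 3) g).map (fun x => |x j|) = volume.restrict (Ioc (0 : ℝ) 1) := by
      have hmem : ∀ᵐ y ∂(law (k + 3) g).map (fun x => |x j|), y ∈ Icc (0 : ℝ) 1 := by
        refine (ae_map_iff hmabs.aemeasurable measurableSet_Icc).2 ?_
        filter_upwards [ae_law_mem_balancedPolytope (k + 3) g] with x hx
        exact ⟨abs_nonneg _, abs_le.2 (hx.1 j)⟩
      have hmem' : ∀ᵐ y ∂volume.restrict (Ioc (0 : ℝ) 1), y ∈ Icc (0 : ℝ) 1 :=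
        (ae_restrict_mem measurableSet_Ioc).mono fun y hy => Ioc_subset_Icc_self hy
      have : IsFiniteMeasure ((law (k + 3) g).map (fun x => |x j|)) :=
        inferInstance
      refine ext_of_integral_pow_eq hmem hmem' fun m => ?_
      rw [integral_eq_lintegral_of_nonneg_ae (hmem.mono fun y hy => pow_nonneg hy.1 m)
          (by fun_prop),
        integral_eq_lintegral_of_nonneg_ae (hmem'.mono fun y hy => pow_nonneg hy.1 m)
          (by fun_prop),
        lintegral_map (by fun_prop) hmabs]
      -- Only the integers `s = m + 1` are used: the hypothesis for all `s` is redundant.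
      have hm := h (m + 1) (by positivity)
      rw [← lintegral_rpow_sub_one (by positivity)] at hm
      simp only [add_sub_cancel_right, Real.rpow_natCast] at hm
      rw [hm]
    refine Measure.ext_of_lintegral _ fun F hF => ?_
    have hFneg : Measurable fun y => F (-y) := by fun_prop
    have hsum : Measurable fun y => F y + F (-y) := by fun_prop
    have hneg := lintegral_law_neg k hg (F := fun x => F (x j)) (by fun_prop)
    -- By symmetry `2 E F(X_j) = E[F(X_j) + F(-X_j)]`, which depends on `|X_j|` alone.
    have hsymm : 2 * ∫⁻ x, F (x j) ∂law (k + 3) g = ∫⁻ y in Ioc 0 1, (F y + F (-y)) := by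
      rw [← habs, lintegral_map hsum hmabs, two_mul]
      conv_lhs => rw [← hneg, add_comm, hneg]
      conv_lhs => enter [2]; rw [← hneg]
      rw [← lintegral_add_left (by fun_prop)]
      refine lintegral_congr fun x => ?_
      rcases abs_choice (x j) with hx | hx <;> rw [hx] <;> simp [add_comm]
    rw [lintegral_map hF hmj, lintegral_cond_Icc hF, ← hsymm, ← mul_assoc,
      ENNReal.inv_mul_cancel (by norm_num) (by norm_num), one_mul]

/-- Only uniformity has content, and its moment condition is the same for every coordinate. -/
lemma isRBSDistribution_law_iff (k : ℕ) {g : ℝ → ℝ} (hg : Measurable g)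
    (h1 : ∫⁻ t in Ioc 0 1, ENNReal.ofReal (g t) = 1) :
    IsRBSDistribution (law (k + 3) g) ↔ ∀ s : ℝ, 0 < s →
      (k + 3 : ℝ≥0∞)⁻¹ * (unitMoment g s * (1 + (k + 2) * unitMoment (sliceDensity k) s)) =
        ENNReal.ofReal (1 / s) := by
  constructor
  · intro h s hs
    rw [← lintegral_rpow_abs_apply_law k hg 0 s]
    exact (map_apply_law_eq_cond_iff k hg h1 0).1 (h.uniform 0) s hs
  · intro h
    exact
      { isProbabilityMeasure := isProbabilityMeasure_law k hg h1
        measurable := fun j => by fun_prop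
        balanced := (ae_law_mem_balancedPolytope (k + 3) g).mono fun x hx => hx.2
        uniform := fun j => (map_apply_law_eq_cond_iff k hg h1 j).2 fun s hs => by
          rw [lintegral_rpow_abs_apply_law k hg j s, h s hs] }

/-- Used with `A` and `B` the moments of `g` and of the slice density. The other factors on the left
are nonzero, so `A = ∞` would make that side infinite: the identity in `[0, ∞]` already contains
convergence. -/
lemma moment_identity_iff (k : ℕ) {A B : ℝ≥0∞} (hB : B < ∞) {s : ℝ} (hs : 0 < s) :
    (k + 3 : ℝ≥0∞)⁻¹ * (A * (1 + (k + 2) * B)) = ENNReal.ofReal (1 / s) ↔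
      A < ∞ ∧ A.toReal = ((k + 3 : ℕ) : ℝ) /
        (s * (1 + (((k + 3 : ℕ) : ℝ) - 1) * B.toReal)) := by
  have hcast : ((k + 3 : ℝ≥0∞)⁻¹).toReal = (k + 3 : ℝ)⁻¹ := by
    rw [ENNReal.toReal_inv, ENNReal.toReal_add (by simp) (by simp)]; simp
  have hBfin : (k + 2 : ℝ≥0∞) * B ≠ ∞ := ENNReal.mul_ne_top (by finiteness) hB.ne
  have hD : (1 + (k + 2) * B : ℝ≥0∞) ≠ ∞ := ENNReal.add_ne_top.2 ⟨by simp, hBfin⟩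
  have hDr : (1 + (k + 2) * B : ℝ≥0∞).toReal = 1 + (k + 2) * B.toReal := by
    rw [ENNReal.toReal_add (by simp) hBfin, ENNReal.toReal_mul,
      ENNReal.toReal_add (by simp) (by simp)]
    simp
  have hDpos : 0 < 1 + (k + 2) * B.toReal := by positivity
  have hk : (k + 3 : ℝ) ≠ 0 := by positivity
  have hreal : (k + 3 : ℝ)⁻¹ * (A.toReal * (1 + (k + 2) * B.toReal)) = 1 / s ↔
      A.toReal = ((k + 3 : ℕ) : ℝ) / (s * (1 + (((k + 3 : ℕ) : ℝ) - 1) * B.toReal)) := by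
    have e : 1 + (((k + 3 : ℕ) : ℝ) - 1) * B.toReal = 1 + (k + 2) * B.toReal := by
      push_cast; ring
    rw [e, inv_mul_eq_div, div_eq_div_iff hk hs.ne', eq_div_iff (by positivity)]
    push_cast
    constructor <;> intro h <;> linarith
  have hk3 : (k + 3 : ℝ≥0∞)⁻¹ ≠ 0 := ENNReal.inv_ne_zero.2 (by finiteness)
  constructor
  · intro h
    have hA : A ≠ ∞ := by
      rintro rfl
      rw [ENNReal.top_mul (by positivity), ENNReal.mul_top hk3] at h
      exact ENNReal.ofReal_ne_top h.symm
    refine ⟨hA.lt_top, hreal.1 ?_⟩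
    have := congrArg ENNReal.toReal h
    rwa [ENNReal.toReal_mul, ENNReal.toReal_mul, hcast, hDr,
      ENNReal.toReal_ofReal (by positivity)] at this
  · rintro ⟨hA, h⟩
    rw [← ENNReal.ofReal_toReal (a := (k + 3 : ℝ≥0∞)⁻¹ * (A * (1 + (k + 2) * B)))
      (ENNReal.mul_ne_top (by simp) (ENNReal.mul_ne_top hA.ne hD)), ENNReal.toReal_mul,
      ENNReal.toReal_mul, hcast, hDr, hreal.2 h]

lemma bigQ_eq (k : ℕ) (hn : 3 ≤ k + 3) :
    bigQ (k + 3) hn = fun t => heaviside t * sliceDensity k (Real.exp (-t)) := by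
  funext t
  rw [bigQ]
  by_cases ht : 0 ≤ t
  · rw [derivWithin_sliceCDF k hn ⟨(Real.exp_pos _).le, Real.exp_le_one_iff.2 (by linarith)⟩]
  · simp [heaviside, ht]

lemma unitMoment_congr {f g : ℝ → ℝ} (h : f =ᵐ[volume.restrict (Ioc 0 1)] g) (s : ℝ) :
    unitMoment f s = unitMoment g s :=
  lintegral_congr_ae (h.mono fun r hr => by simp only [hr])

end

end GerowRobson

theorem proposition3p3 (n : ℕ) (hn : 3 ≤ n) (g : ℝ → ℝ)
    (hg : GerowRobson.IsUnitIntervalDensity g) :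
    DifferentiableOn ℝ (GerowRobson.sliceCDF n hn) (Set.Icc 0 1) ∧
    (∀ s : ℝ, 0 < s → GerowRobson.LaplaceConverges (GerowRobson.bigQ n hn) s) ∧
    (GerowRobson.IsRBSDistribution (GerowRobson.law n g) ↔
      ∀ s : ℝ, 0 < s →
        GerowRobson.LaplaceConverges (GerowRobson.smallQ g) s ∧
        GerowRobson.laplace (GerowRobson.smallQ g) s =
          n / (s * (1 + ((n : ℝ) - 1) *
            GerowRobson.laplace (GerowRobson.bigQ n hn) s))) := by
  open GerowRobson in
  -- `k` is the number of coordinates of `(Z_2, ..., Z_n)` still free once `Z_2` and the sum are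
  -- fixed.
  obtain ⟨k, rfl⟩ : ∃ k, n = k + 3 := ⟨n - 3, by omega⟩
  have hpm : AEStronglyMeasurable (sliceDensity k) (volume.restrict (Ioc 0 1)) :=
    (measurable_sliceDensity k).aestronglyMeasurable
  have hp0 : ∀ r ∈ Ioc (0 : ℝ) 1, 0 ≤ sliceDensity k r := fun r _ => sliceDensity_nonneg k r
  have hgm : AEStronglyMeasurable g (volume.restrict (Icc 0 1)) :=
    hg.integrableOn.aestronglyMeasurable
  have hgm' : AEStronglyMeasurable g (volume.restrict (Ioc 0 1)) :=
    hgm.mono_measure (Measure.restrict_mono Ioc_subset_Icc_self le_rfl)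
  have hg0 : ∀ r ∈ Ioc (0 : ℝ) 1, 0 ≤ g r := fun r hr => hg.nonneg r (Ioc_subset_Icc_self hr)
  -- Integrability makes `g` only almost everywhere measurable; neither the law nor the moments see
  -- the change of representative.
  have hae : g =ᵐ[volume.restrict (Icc 0 1)] hgm.mk g := hgm.ae_eq_mk
  have hae' : g =ᵐ[volume.restrict (Ioc 0 1)] hgm.mk g :=
    ae_restrict_of_ae_restrict_of_subset Ioc_subset_Icc_self hae
  have hmeas : Measurable (hgm.mk g) := hgm.stronglyMeasurable_mk.measurable
  have hmass : ∫⁻ t in Ioc 0 1, ENNReal.ofReal (hgm.mk g t) = 1 := by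
    rw [← lintegral_congr_ae (hae'.mono fun t ht => congrArg ENNReal.ofReal ht),
      ← ofReal_integral_eq_lintegral_ofReal (hg.integrableOn.mono_set Ioc_subset_Icc_self)
        ((ae_restrict_mem measurableSet_Ioc).mono hg0), ← integral_Icc_eq_integral_Ioc,
      hg.integral_eq_one, ENNReal.ofReal_one]
  refine ⟨fun r hr => (hasDerivWithinAt_sliceCDF k hn hr).differentiableWithinAt,
    fun s hs => ?_, ?_⟩
  · rw [bigQ_eq]
    exact (laplaceConverges_iff_unitMoment hpm hp0 s).2 (unitMoment_sliceDensity_lt_top k hs)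
  · rw [law_congr k hae, isRBSDistribution_law_iff k hmeas hmass]
    refine forall₂_congr fun s hs => ?_
    rw [← unitMoment_congr hae', moment_identity_iff k (unitMoment_sliceDensity_lt_top k hs) hs,
      bigQ_eq, laplace_eq_toReal_unitMoment hpm hp0]
    exact and_congr (laplaceConverges_iff_unitMoment hgm' hg0 s).symm
      (by rw [← laplace_eq_toReal_unitMoment hgm' hg0 s]; rfl)
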